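/- Let $\Lambda\subset\mathbb{R}^2$ be a planar lattice (a discrete subgroup of the Euclidean plane spanning it over $\mathbb{R}$). A coincidence reflection of $\Lambda$ is an orthogonal reflection $R$ in a line through the origin such that $\Lambda\cap R\Lambda$ has full rank, and its coincidence index is the group index $[\Lambda:\Lambda\cap R\Lambda]$. A lattice is well-rounded if its nonzero vectors of minimal length span $\mathbb{R}^2$. Suppose that $\Lambda$ has exactly two coincidence reflections. Then both have the same coincidence index $\Sigma\in\mathbb{N}$, $\Sigma \geq 1$; for every $n\geq 1$ the number $a_\Lambda(n)$ of well-rounded sublattices of $\Lambda$ of index $n$ is finite; and the summatory function $A_\Lambda(x)=\sum_{n\le x}a_\Lambda(n)$ satisfies $$A_\Lambda(x)=\frac{\log 3}{4\Sigma}\,x+O(\sqrt{x})\qquad (x\to\infty),$$ where the implied constant may depend on $\Lambda$. In particular, the leading term depends only on $\Sigma$. -/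

import Mathlib

open Asymptotics Filter

/-- The vectors of minimal nonzero length of a lattice. -/
def minimalVectors {E : Type*} [NormedAddCommGroup E] (M : Submodule ℤ E) : Set E :=
  {v | v ∈ M ∧ v ≠ 0 ∧ ∀ w ∈ M, w ≠ 0 → ‖v‖ ≤ ‖w‖}

/-- A lattice is well-rounded if its vectors of minimal nonzero length span the ambient space. -/
def IsWellRounded {E : Type*} [NormedAddCommGroup E] [NormedSpace ℝ E]
    (M : Submodule ℤ E) : Prop :=
  Submodule.span ℝ (minimalVectors M) = ⊤

/-- The index of `M` in `L` as additive groups (`0` encodes infinite index); used for `M ≤ L`. -/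
noncomputable def latticeIndex {E : Type*} [AddCommGroup E] (L M : Submodule ℤ E) : ℕ :=
  M.toAddSubgroup.relIndex L.toAddSubgroup

/-- The intersection `L ∩ R L`, for a linear isometry `R`. -/
def cslOf {E : Type*} [NormedAddCommGroup E] [NormedSpace ℝ E]
    (L : Submodule ℤ E) (R : E ≃ₗᵢ[ℝ] E) : Submodule ℤ E :=
  L ⊓ L.map (R.toLinearEquiv.toLinearMap.restrictScalars ℤ)

/-- `R` is a coincidence isometry of `L` if `L ∩ R L` has full rank. -/
def IsCoincidenceIsometry {E : Type*} [NormedAddCommGroup E] [NormedSpace ℝ E]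
    (L : Submodule ℤ E) (R : E ≃ₗᵢ[ℝ] E) : Prop :=
  Submodule.span ℝ (cslOf L R : Set E) = ⊤

/-- The coincidence index: the index of `L ∩ R L` in `L`. -/
noncomputable def coincidenceIndex {E : Type*} [NormedAddCommGroup E] [NormedSpace ℝ E]
    (L : Submodule ℤ E) (R : E ≃ₗᵢ[ℝ] E) : ℕ :=
  latticeIndex L (cslOf L R)

/-- A coincidence reflection of `L`: a coincidence isometry that is the orthogonal reflection
in the hyperplane (in the plane: the line) perpendicular to a nonzero vector. -/
def IsCoincidenceReflection {E : Type*} [NormedAddCommGroup E] [InnerProductSpace ℝ E]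
    (L : Submodule ℤ E) (R : E ≃ₗᵢ[ℝ] E) : Prop :=
  (∃ v : E, v ≠ 0 ∧ R = (Submodule.span ℝ {v})ᗮ.reflection) ∧ IsCoincidenceIsometry L R

/-- The well-rounded sublattices of `L` of index `n`. -/
def wellRoundedSublattices {E : Type*} [NormedAddCommGroup E] [NormedSpace ℝ E]
    (L : Submodule ℤ E) (n : ℕ) : Set (Submodule ℤ E) :=
  {M | M ≤ L ∧ latticeIndex L M = n ∧ IsWellRounded M}

/-- The summatory function of `n ↦ #{well-rounded sublattices of index n}`, `1 ≤ n ≤ x`. -/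
noncomputable def wellRoundedCount {E : Type*} [NormedAddCommGroup E] [NormedSpace ℝ E]
    (L : Submodule ℤ E) (x : ℝ) : ℕ :=
  ∑ n ∈ Finset.Icc 1 ⌊x⌋₊, (wellRoundedSublattices L n).ncard

/-! A well-rounded lattice M in the plane has a basis a, b of minimal vectors of equal length. The
reflection swapping a and b, and the one swapping a and -b, preserve M, so they are coincidence
reflections of every lattice containing M. If L has only two coincidence reflections, their axes are
orthogonal (R and -R share the coincidence lattice K), and a + b and a - b lie on these two axes.

The lattice K is rectangular or centred rectangular: in suitable axis vectors e, f it is given by q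
≡ p mod d with d = 1 or 2 (`exists_isCongruenceLattice_cslOf`). Hence M is spanned by p e ± q f with
p, q > 0 (`IsCongruenceLattice.exists_eq_rhombicLattice`). It lies in K, has index (2/d) p q Σ in L,
and is well-rounded exactly when neither of 2p e, 2q f is shorter than p e + q f. The pair (p, q) is
determined by M.

Counting thus means counting congruent pairs in a sector r p ≤ q ≤ 3 r p under a hyperbola p q ≤ y.
The area is (log 3 / 2) y and the density 1/d (`ncard_sectorPairs_isBigO`). With y = d x / (2Σ) the
parameter d cancels. -/

/-! ### Counting congruent pairs in a sector under a hyperbola -/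

lemma abs_card_modEq_sub_le {d : ℕ} (hd : 0 < d) (v : ℕ) {a b : ℝ} (ha : 0 < a) (hab : a ≤ b) :
    |((((Finset.Icc ⌈a⌉₊ ⌊b⌋₊).filter (fun q => q ≡ v [MOD d])).card : ℕ) : ℝ) - (b - a) / d|
      ≤ 2 := by
  -- Since a > 0, the ceiling is at least 1 and the truncated subtraction is exact.
  have h1 : Finset.Icc ⌈a⌉₊ ⌊b⌋₊ = Finset.Ioc (⌈a⌉₊ - 1) ⌊b⌋₊ := by
    ext q
    have := Nat.ceil_pos.2 ha
    simp only [Finset.mem_Icc, Finset.mem_Ioc]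
    omega
  have h2 := Nat.Ioc_filter_modEq_card (⌈a⌉₊ - 1) ⌊b⌋₊ hd v
  rw [h1]
  set c := ((Finset.Ioc (⌈a⌉₊ - 1) ⌊b⌋₊).filter (fun q => q ≡ v [MOD d])).card
  set F := ⌊(((⌊b⌋₊ : ℕ) : ℚ) - (v : ℚ)) / (d : ℚ)⌋ with hF
  set G := ⌊(((⌈a⌉₊ - 1 : ℕ) : ℚ) - (v : ℚ)) / (d : ℚ)⌋ with hG
  have hdq : (0 : ℚ) < d := by exact_mod_cast hd
  have hdr : (1 : ℝ) ≤ d := by exact_mod_cast hd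
  have hb0 : 0 ≤ b := ha.le.trans hab
  have F1 : (F : ℚ) * d ≤ (⌊b⌋₊ : ℕ) - (v : ℚ) := (le_div_iff₀ hdq).1 (Int.floor_le _)
  have F2 : ((⌊b⌋₊ : ℕ) : ℚ) - v < (F + 1) * d := (div_lt_iff₀ hdq).1 (Int.lt_floor_add_one _)
  have G1 : (G : ℚ) * d ≤ ((⌈a⌉₊ - 1 : ℕ) : ℚ) - (v : ℚ) := (le_div_iff₀ hdq).1 (Int.floor_le _)
  have G2 : ((⌈a⌉₊ - 1 : ℕ) : ℚ) - v < (G + 1) * d :=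
    (div_lt_iff₀ hdq).1 (Int.lt_floor_add_one _)
  rw [Nat.cast_sub (Nat.ceil_pos.2 ha)] at G1 G2
  have F1' : (F : ℝ) * d ≤ (⌊b⌋₊ : ℕ) - (v : ℝ) := by exact_mod_cast F1
  have F2' : ((⌊b⌋₊ : ℕ) : ℝ) - v < (F + 1) * d := by exact_mod_cast F2
  have G1' : (G : ℝ) * d ≤ (⌈a⌉₊ : ℕ) - ((1 : ℕ) : ℝ) - (v : ℝ) := by exact_mod_cast G1
  have G2' : ((⌈a⌉₊ : ℕ) : ℝ) - ((1 : ℕ) : ℝ) - v < (G + 1) * d := by exact_mod_cast G2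
  have b1 := Nat.floor_le hb0
  have b2 := Nat.lt_floor_add_one b
  have a1 := Nat.le_ceil a
  have a2 := Nat.ceil_lt_add_one ha.le
  have hc : (c : ℝ) = max ((F : ℝ) - G) 0 := by
    have := congrArg (fun z : ℤ => (z : ℝ)) h2
    push_cast at this
    exact this
  push_cast at G1' G2'
  have hd0 : (0 : ℝ) < d := by linarith
  have hm : (b - a) / d * d = b - a := div_mul_cancel₀ _ hd0.ne'
  have h0 : 0 ≤ (b - a) / d := div_nonneg (by linarith) hd0.le
  set t := (b - a) / d
  have k1 : (F : ℝ) - G - t ≤ 2 := by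
    by_contra! h
    nlinarith
  have k2 : -2 ≤ (F : ℝ) - G - t := by
    by_contra! h
    nlinarith
  rw [hc, abs_le]
  constructor
  · linarith [le_max_left ((F : ℝ) - G) 0]
  · rcases max_cases ((F : ℝ) - G) 0 with h | h <;> rw [h.1] <;> linarith

lemma abs_sum_Ioc_floor_sub_le {t : ℝ} (ht : 0 ≤ t) :
    |∑ p ∈ Finset.Ioc 0 ⌊t⌋₊, (p : ℝ) - t ^ 2 / 2| ≤ t := by
  have key : ∀ n : ℕ, ∑ p ∈ Finset.Ioc 0 n, (p : ℝ) = n * (n + 1) / 2 := by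
    intro n
    induction n with
    | zero => simp
    | succ n ih => rw [Finset.sum_Ioc_succ_top (Nat.zero_le _), ih]; push_cast; ring
  rw [key]
  have h1 := Nat.floor_le ht
  have h2 := Nat.lt_floor_add_one t
  have h3 : (0 : ℝ) ≤ (⌊t⌋₊ : ℕ) := Nat.cast_nonneg _
  rw [abs_le]
  constructor <;> nlinarith

lemma abs_harmonic_floor_sub_log_le {t : ℝ} (ht : 1 ≤ t) :
    |(harmonic ⌊t⌋₊ : ℝ) - Real.log t - Real.eulerMascheroniConstant| ≤ 2 / t := by
  have hn : 1 ≤ ⌊t⌋₊ := Nat.le_floor (by simpa using ht)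
  have h1 := Nat.floor_le (zero_le_one.trans ht)
  have h2 := Nat.lt_floor_add_one t
  have e1 := Real.eulerMascheroniSeq_lt_eulerMascheroniConstant ⌊t⌋₊
  have e2 := Real.eulerMascheroniConstant_lt_eulerMascheroniSeq' ⌊t⌋₊
  rw [Real.eulerMascheroniSeq] at e1
  rw [Real.eulerMascheroniSeq', if_neg (by omega)] at e2
  set n := ⌊t⌋₊
  have hn' : (1 : ℝ) ≤ n := by exact_mod_cast hn
  have l1 : Real.log n ≤ Real.log t := Real.log_le_log (by linarith) h1
  have l2 : Real.log t ≤ Real.log (n + 1) := Real.log_le_log (by linarith) h2.le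
  have l3 : Real.log (n + 1) - Real.log n ≤ 1 / n := by
    rw [← Real.log_div (by linarith) (by linarith)]
    have := Real.log_le_sub_one_of_pos (x := ((n : ℝ) + 1) / n) (by positivity)
    refine this.trans (le_of_eq ?_)
    field_simp
    ring
  have l4 : 1 / (n : ℝ) ≤ 2 / t := by
    rw [div_le_div_iff₀ (by linarith) (by linarith)]
    linarith
  rw [abs_le]
  constructor <;> linarith

lemma sum_Ioc_inv_eq_harmonic_sub {m n : ℕ} (h : m ≤ n) :
    ∑ p ∈ Finset.Ioc m n, (p : ℝ)⁻¹ = (harmonic n : ℝ) - harmonic m := by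
  induction n, h using Nat.le_induction with
  | base => simp
  | succ n hn ih =>
    rw [Finset.sum_Ioc_succ_top (by omega), ih, harmonic_succ]
    push_cast
    ring

/-- The minimum switches branch at p = A. The quadratic terms 3A²/2 from p ≤ A and from the
subtracted sum cancel, leaving the harmonic sum over A < p ≤ √3 A, whose main term is log √3. -/
lemma abs_sum_min_sub_le {A : ℝ} (hA : 1 ≤ A) :
    |∑ p ∈ Finset.Ioc 0 ⌊√3 * A⌋₊, (min (3 * (p : ℝ)) (3 * A ^ 2 / p) - p)
      - 3 * A ^ 2 / 2 * Real.log 3| ≤ 20 * A := by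
  have s1 : (1 : ℝ) ≤ √3 := Real.one_le_sqrt.2 (by norm_num)
  have s2 : √3 ≤ 2 := by rw [Real.sqrt_le_left (by norm_num)]; norm_num
  have s3 : √3 ^ 2 = 3 := Real.sq_sqrt (by norm_num)
  have hAB : A ≤ √3 * A := by nlinarith
  have hfl : ⌊A⌋₊ ≤ ⌊√3 * A⌋₊ := Nat.floor_le_floor hAB
  rw [Finset.sum_sub_distrib, ← Finset.sum_Ioc_consecutive _ (Nat.zero_le _) hfl]
  have c1 : ∑ p ∈ Finset.Ioc 0 ⌊A⌋₊, min (3 * (p : ℝ)) (3 * A ^ 2 / p)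
      = 3 * ∑ p ∈ Finset.Ioc 0 ⌊A⌋₊, (p : ℝ) := by
    rw [Finset.mul_sum]
    refine Finset.sum_congr rfl fun p hp => min_eq_left ?_
    rw [Finset.mem_Ioc] at hp
    have h0 : (0 : ℝ) < p := by exact_mod_cast hp.1
    have h1 : (p : ℝ) ≤ A := (Nat.le_floor_iff (by linarith)).1 hp.2
    rw [le_div_iff₀ h0]
    nlinarith
  have c2 : ∑ p ∈ Finset.Ioc ⌊A⌋₊ ⌊√3 * A⌋₊, min (3 * (p : ℝ)) (3 * A ^ 2 / p)
      = 3 * A ^ 2 * ((harmonic ⌊√3 * A⌋₊ : ℝ) - harmonic ⌊A⌋₊) := by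
    rw [← sum_Ioc_inv_eq_harmonic_sub hfl, Finset.mul_sum]
    refine Finset.sum_congr rfl fun p hp => ?_
    rw [Finset.mem_Ioc] at hp
    have h1 : A < p := (Nat.floor_lt (by linarith)).1 hp.1
    rw [min_eq_right, div_eq_mul_inv]
    rw [div_le_iff₀ (by linarith)]
    nlinarith
  rw [c1, c2]
  have i1 := abs_sum_Ioc_floor_sub_le (t := A) (by linarith)
  have i2 := abs_sum_Ioc_floor_sub_le (t := √3 * A) (by nlinarith)
  have i3 := abs_harmonic_floor_sub_log_le hA
  have i4 := abs_harmonic_floor_sub_log_le (hA.trans hAB)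
  have hlog : Real.log (√3 * A) = Real.log 3 / 2 + Real.log A := by
    rw [Real.log_mul (by positivity) (by positivity), Real.log_sqrt (by norm_num)]
  have i5 : 2 / (√3 * A) ≤ 2 / A := by gcongr
  rw [hlog] at i4
  rw [abs_le] at *
  rw [mul_pow, s3] at i2
  -- Euler's constant cancels in the difference; each harmonic sum costs at most 2 / A.
  have hE : |(harmonic ⌊√3 * A⌋₊ : ℝ) - harmonic ⌊A⌋₊ - Real.log 3 / 2| ≤ 4 / A := by
    have : 4 / A = 2 / A + 2 / A := by ring
    rw [abs_le]
    constructor <;> linarith [i3.1, i3.2, i4.1, i4.2]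
  obtain ⟨E, hEd⟩ : ∃ E, E = (harmonic ⌊√3 * A⌋₊ : ℝ) - harmonic ⌊A⌋₊ - Real.log 3 / 2 := ⟨_, rfl⟩
  have hE2 : (harmonic ⌊√3 * A⌋₊ : ℝ) - harmonic ⌊A⌋₊ = E + Real.log 3 / 2 := by rw [hEd]; ring
  rw [← hEd] at hE
  have hE3 : |A ^ 2 * E| ≤ 4 * A := by
    rw [abs_mul, abs_of_nonneg (sq_nonneg A)]
    calc A ^ 2 * |E| ≤ A ^ 2 * (4 / A) := by gcongr
      _ = 4 * A := by field_simp
  rw [abs_le] at hE3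
  rw [hE2]
  have hB : √3 * A ≤ 2 * A := by nlinarith
  constructor <;> nlinarith [i1.1, i1.2, i2.1, i2.2, hE3.1, hE3.2]

/-- Pairs of positive integers, congruent modulo `d`, in the sector `r p ≤ q ≤ 3 r p`, with
product at most `y`. -/
def sectorPairs (d : ℕ) (r y : ℝ) : Set (ℕ × ℕ) :=
  {z | 0 < z.1 ∧ 0 < z.2 ∧ z.2 ≡ z.1 [MOD d] ∧ r * z.1 ≤ z.2 ∧ (z.2 : ℝ) ≤ 3 * r * z.1 ∧
    (z.1 * z.2 : ℝ) ≤ y}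

/-- Slicing by p. Writing the bound as 3rA² puts the corners of the region at p = A, where q = 3rp
meets the hyperbola, and at p = √3 A, where q = rp does. -/
lemma ncard_sectorPairs (d : ℕ) {r A : ℝ} (hr : 0 < r) (hA : 0 ≤ A) :
    (sectorPairs d r (3 * r * A ^ 2)).ncard = ∑ p ∈ Finset.Ioc 0 ⌊√3 * A⌋₊,
      ((Finset.Icc ⌈r * p⌉₊ ⌊r * min (3 * (p : ℝ)) (3 * A ^ 2 / p)⌋₊).filter
        (fun q => q ≡ p [MOD d])).card := by
  rw [← Finset.card_sigma, ← Finset.card_map (Equiv.sigmaEquivProd ℕ ℕ).toEmbedding,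
    ← Set.ncard_coe_finset]
  congr 1
  ext ⟨p, q⟩
  simp only [sectorPairs, Set.mem_ofPred_eq, Finset.coe_map, Set.mem_image, Finset.mem_coe,
    Finset.mem_sigma, Finset.mem_Ioc, Finset.mem_filter, Finset.mem_Icc, Sigma.exists]
  have s3 : √3 ^ 2 = 3 := Real.sq_sqrt (by norm_num)
  have key : ∀ p q : ℕ, 0 < p → (q ≤ ⌊r * min (3 * (p : ℝ)) (3 * A ^ 2 / p)⌋₊ ↔
      (q : ℝ) ≤ 3 * r * p ∧ (p * q : ℝ) ≤ 3 * r * A ^ 2) := by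
    intro p q hp
    have hp' : (0 : ℝ) < p := by exact_mod_cast hp
    rw [Nat.le_floor_iff (by positivity), mul_min_of_nonneg _ _ hr.le, le_min_iff, ← mul_div_assoc,
      le_div_iff₀ hp']
    constructor <;> rintro ⟨h1, h2⟩ <;> constructor <;> linarith
  constructor
  · rintro ⟨h1, h2, h3, h4, h5, h6⟩
    refine ⟨p, q, ⟨⟨h1, ?_⟩, ⟨Nat.ceil_le.2 h4, (key p q h1).2 ⟨h5, h6⟩⟩, h3⟩, rfl⟩
    have hp' : (0 : ℝ) < p := by exact_mod_cast h1
    rw [Nat.le_floor_iff (by positivity)]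
    -- The bound on p comes from r p² ≤ p q ≤ 3 r A².
    refine le_of_sq_le_sq ?_ (by positivity)
    rw [mul_pow, s3]
    have : r * (p : ℝ) ^ 2 ≤ r * (3 * A ^ 2) := by nlinarith
    exact le_of_mul_le_mul_left this hr
  · rintro ⟨p', q', ⟨⟨h1, h2⟩, ⟨h3, h4⟩, h5⟩, h6⟩
    obtain ⟨rfl, rfl⟩ := Prod.mk.inj h6
    obtain ⟨h7, h8⟩ := (key p' q' h1).1 h4
    have hp' : (0 : ℝ) < p' := by exact_mod_cast h1
    have h9 := Nat.ceil_le.1 h3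
    refine ⟨h1, ?_, h5, h9, h7, h8⟩
    have : (0 : ℝ) < q' := lt_of_lt_of_le (by positivity) h9
    exact_mod_cast this

/-- Each slice deviates from its length over d by at most 2, and there are at most 2A slices, whence
4A; the sum of the lengths contributes 20rA. -/
lemma abs_ncard_sectorPairs_sub_le {d : ℕ} (hd : 0 < d) {r A : ℝ} (hr : 0 < r) (hA : 1 ≤ A) :
    |((sectorPairs d r (3 * r * A ^ 2)).ncard : ℝ)
      - Real.log 3 / (2 * d) * (3 * r * A ^ 2)| ≤ (4 + 20 * r) * A := by
  have hA0 : (0 : ℝ) ≤ A := by linarith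
  rw [ncard_sectorPairs d hr hA0]
  push_cast
  have s2 : √3 ≤ 2 := by rw [Real.sqrt_le_left (by norm_num)]; norm_num
  have s3 : √3 ^ 2 = 3 := Real.sq_sqrt (by norm_num)
  have hd1 : (1 : ℝ) ≤ d := by exact_mod_cast hd
  set c : ℕ → ℝ := fun p => ((((Finset.Icc ⌈r * (p : ℝ)⌉₊
    ⌊r * min (3 * (p : ℝ)) (3 * A ^ 2 / p)⌋₊).filter (fun q => q ≡ p [MOD d])).card : ℕ) : ℝ)
  set m : ℕ → ℝ := fun p => min (3 * (p : ℝ)) (3 * A ^ 2 / p) - p with hm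
  have h1 : |∑ p ∈ Finset.Ioc 0 ⌊√3 * A⌋₊, c p - ∑ p ∈ Finset.Ioc 0 ⌊√3 * A⌋₊, r / d * m p|
      ≤ 4 * A := by
    rw [← Finset.sum_sub_distrib]
    refine (Finset.abs_sum_le_sum_abs _ _).trans ?_
    have : ∀ p ∈ Finset.Ioc 0 ⌊√3 * A⌋₊, |c p - r / d * m p| ≤ 2 := by
      intro p hp
      rw [Finset.mem_Ioc] at hp
      have hp' : (0 : ℝ) < p := by exact_mod_cast hp.1
      have hpB := (Nat.le_floor_iff (by positivity)).1 hp.2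
      have hle : (p : ℝ) ≤ min (3 * (p : ℝ)) (3 * A ^ 2 / p) := by
        refine le_min (by linarith) ?_
        rw [le_div_iff₀ hp']
        have := mul_self_le_mul_self hp'.le hpB
        nlinarith
      have := abs_card_modEq_sub_le hd p (a := r * p)
        (b := r * min (3 * (p : ℝ)) (3 * A ^ 2 / p)) (by positivity) (by gcongr)
      convert this using 3
      simp only [hm]
      ring
    refine (Finset.sum_le_card_nsmul _ _ _ this).trans ?_
    have := Nat.floor_le (a := √3 * A) (by positivity)
    simp only [Nat.card_Ioc, tsub_zero, nsmul_eq_mul]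
    nlinarith
  have h2 := abs_sum_min_sub_le hA
  rw [← Finset.mul_sum] at h1
  set S := ∑ p ∈ Finset.Ioc 0 ⌊√3 * A⌋₊, m p
  have h3 : |r / d * S - Real.log 3 / (2 * d) * (3 * r * A ^ 2)| ≤ 20 * r * A := by
    have : r / d * S - Real.log 3 / (2 * d) * (3 * r * A ^ 2)
        = r / d * (S - 3 * A ^ 2 / 2 * Real.log 3) := by
      field_simp
    rw [this, abs_mul, abs_of_nonneg (by positivity)]
    have h4 : r / d ≤ r := div_le_self hr.le hd1
    calc r / d * |S - 3 * A ^ 2 / 2 * Real.log 3| ≤ r * (20 * A) := by gcongr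
      _ = 20 * r * A := by ring
  calc _ ≤ _ := abs_sub_le _ (r / d * S) _
    _ ≤ 4 * A + 20 * r * A := add_le_add h1 h3
    _ = _ := by ring

theorem ncard_sectorPairs_isBigO {d : ℕ} (hd : 0 < d) {r : ℝ} (hr : 0 < r) :
    (fun y : ℝ => ((sectorPairs d r y).ncard : ℝ) - Real.log 3 / (2 * d) * y)
      =O[atTop] (fun y : ℝ => √y) := by
  refine IsBigO.of_bound ((4 + 20 * r) / √(3 * r)) ?_
  filter_upwards [eventually_ge_atTop (3 * r)] with y hy
  have h3 : 0 < 3 * r := by positivity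
  have hA : 1 ≤ √(y / (3 * r)) := Real.one_le_sqrt.2 ((one_le_div h3).2 hy)
  have h := abs_ncard_sectorPairs_sub_le hd hr hA
  have hy0 : 0 ≤ y / (3 * r) := div_nonneg (by linarith) h3.le
  rw [Real.sq_sqrt hy0, mul_div_cancel₀ _ h3.ne', Real.sqrt_div (by linarith)] at h
  rw [Real.norm_eq_abs, Real.norm_eq_abs, abs_of_nonneg (Real.sqrt_nonneg y)]
  refine h.trans (le_of_eq ?_)
  ring

/-! ### Orthogonal frames and their reflections -/

section OrthogonalPair

variable {E : Type*} [NormedAddCommGroup E] [InnerProductSpace ℝ E]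

/-- Two nonzero orthogonal vectors spanning the plane. -/
structure IsOrthogonalFrame (e f : E) : Prop where
  left_ne : e ≠ 0
  right_ne : f ≠ 0
  inner_eq : inner ℝ e f = 0
  finrank_eq : Module.finrank ℝ E = 2

namespace IsOrthogonalFrame

variable {e f : E}

lemma linearIndependent (h : IsOrthogonalFrame e f) : LinearIndependent ℝ ![e, f] := by
  refine linearIndependent_of_ne_zero_of_inner_eq_zero (𝕜 := ℝ) ?_ ?_
  · intro i
    fin_cases i
    · exact h.left_ne
    · exact h.right_ne
  · intro i j hij
    fin_cases i <;> fin_cases j <;> simp_all [h.inner_eq, real_inner_comm]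

lemma symm (h : IsOrthogonalFrame e f) : IsOrthogonalFrame f e :=
  ⟨h.right_ne, h.left_ne, by rw [real_inner_comm, h.inner_eq], h.finrank_eq⟩

lemma smul (h : IsOrthogonalFrame e f) {s t : ℝ} (hs : s ≠ 0) (ht : t ≠ 0) :
    IsOrthogonalFrame (s • e) (t • f) :=
  ⟨smul_ne_zero hs h.left_ne, smul_ne_zero ht h.right_ne,
    by rw [inner_smul_left, inner_smul_right, h.inner_eq]; simp, h.finrank_eq⟩

/-- The basis of the plane given by an orthogonal frame. -/
noncomputable def basis (h : IsOrthogonalFrame e f) : Module.Basis (Fin 2) ℝ E :=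
  basisOfLinearIndependentOfCardEqFinrank h.linearIndependent (by simp [h.finrank_eq])

lemma coe_basis (h : IsOrthogonalFrame e f) : ⇑h.basis = ![e, f] :=
  coe_basisOfLinearIndependentOfCardEqFinrank _ _

lemma exists_coords (h : IsOrthogonalFrame e f) (x : E) : ∃ a b : ℝ, x = a • e + b • f := by
  refine ⟨h.basis.repr x 0, h.basis.repr x 1, ?_⟩
  have := h.basis.sum_repr x
  rw [Fin.sum_univ_two, h.coe_basis] at this
  simpa using this.symm

lemma coords_ext (h : IsOrthogonalFrame e f) {a b c d : ℝ}
    (hx : a • e + b • f = c • e + d • f) : a = c ∧ b = d := by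
  have := LinearIndependent.pair_iff.1 h.linearIndependent (a - c) (b - d)
    (by rw [sub_smul, sub_smul, sub_add_sub_comm, hx, sub_self])
  exact ⟨sub_eq_zero.1 this.1, sub_eq_zero.1 this.2⟩

lemma det_basis (h : IsOrthogonalFrame e f) (a b c d : ℝ) :
    h.basis.det ![a • e + b • f, c • e + d • f] = a * d - b * c := by
  have h0 : h.basis.repr e = Finsupp.single 0 1 := by
    have := h.basis.repr_self 0
    rwa [h.coe_basis] at this
  have h1 : h.basis.repr f = Finsupp.single 1 1 := by
    have := h.basis.repr_self 1
    rwa [h.coe_basis] at this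
  rw [Module.Basis.det_apply, Matrix.det_fin_two]
  simp [Module.Basis.toMatrix_apply, h0, h1]
  ring

lemma exists_basis (h : IsOrthogonalFrame e f) {a b c d : ℝ} (hdet : a * d - b * c ≠ 0) :
    ∃ B : Module.Basis (Fin 2) ℝ E, ⇑B = ![a • e + b • f, c • e + d • f] := by
  have := (Module.Basis.is_basis_iff_det h.basis (v := ![a • e + b • f, c • e + d • f])).2
    (by rw [h.det_basis]; exact hdet.isUnit)
  exact ⟨Module.Basis.mk this.1 this.2.ge, Module.Basis.coe_mk _ _⟩

lemma inner_coords (h : IsOrthogonalFrame e f) (a b c d : ℝ) :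
    inner ℝ (a • e + b • f) (c • e + d • f) = a * c * ‖e‖ ^ 2 + b * d * ‖f‖ ^ 2 := by
  have h' : inner ℝ f e = 0 := h.symm.inner_eq
  simp only [inner_add_left, inner_add_right, real_inner_smul_left, real_inner_smul_right,
    h.inner_eq, h', real_inner_self_eq_norm_sq]
  ring

lemma norm_sq_coords (h : IsOrthogonalFrame e f) (a b : ℝ) :
    ‖a • e + b • f‖ ^ 2 = a ^ 2 * ‖e‖ ^ 2 + b ^ 2 * ‖f‖ ^ 2 := by
  rw [← real_inner_self_eq_norm_sq, h.inner_coords]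
  ring

/-- The reflection negating `e` and fixing `f`. -/
lemma reflection_coords (h : IsOrthogonalFrame e f) (a b : ℝ) :
    (Submodule.span ℝ {e})ᗮ.reflection (a • e + b • f) = -(a • e) + b • f := by
  rw [map_add, map_smul, map_smul, Submodule.reflection_orthogonalComplement_singleton_eq_neg,
    Submodule.reflection_mem_subspace_eq_self
      (Submodule.mem_orthogonal_singleton_iff_inner_right.2 h.inner_eq), smul_neg]

/-- The reflections along two orthogonal axes differ by -1, and lattices are stable under negation.
This makes coincidence reflections come in pairs with equal index. -/
lemma reflection_symm_apply (h : IsOrthogonalFrame e f) (x : E) :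
    (Submodule.span ℝ {f})ᗮ.reflection x = -(Submodule.span ℝ {e})ᗮ.reflection x := by
  obtain ⟨a, b, rfl⟩ := h.exists_coords x
  rw [h.reflection_coords, add_comm, h.symm.reflection_coords]
  abel

end IsOrthogonalFrame

lemma exists_isOrthogonalFrame (hE : Module.finrank ℝ E = 2) {e : E} (he : e ≠ 0) :
    ∃ f, IsOrthogonalFrame e f := by
  have hb : (Submodule.span ℝ {e})ᗮ ≠ ⊥ := by
    rw [Ne, Submodule.orthogonal_eq_bot_iff]
    intro h
    have := finrank_span_singleton (K := ℝ) he
    rw [h, finrank_top, hE] at this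
    norm_num at this
  obtain ⟨f, hf, hf0⟩ := Submodule.exists_mem_ne_zero_of_ne_bot hb
  exact ⟨f, he, hf0, Submodule.mem_orthogonal_singleton_iff_inner_right.1 hf, hE⟩

lemma span_singleton_eq_of_mem {u v : E} (hv : v ≠ 0) (h : v ∈ Submodule.span ℝ {u}) :
    Submodule.span ℝ {v} = Submodule.span ℝ {u} := by
  obtain ⟨t, rfl⟩ := Submodule.mem_span_singleton.1 h
  exact Submodule.span_singleton_smul_eq (isUnit_iff_ne_zero.2 fun h0 => hv (by simp [h0])) u

lemma mem_span_singleton_of_reflection_eq {u v : E}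
    (h : (Submodule.span ℝ {u})ᗮ.reflection = (Submodule.span ℝ {v})ᗮ.reflection) :
    u ∈ Submodule.span ℝ {v} := by
  have h1 := Submodule.reflection_orthogonalComplement_singleton_eq_neg (𝕜 := ℝ) u
  rw [h, Submodule.reflection_orthogonal_apply, neg_inj] at h1
  exact (Submodule.reflection_eq_self_iff u).1 h1

end OrthogonalPair

/-! ### Indices as ratios of determinants -/

section Index

variable {E : Type*} [NormedAddCommGroup E] [InnerProductSpace ℝ E] [FiniteDimensional ℝ E]
  {ι : Type*} [Fintype ι]

open ZLattice MeasureTheory in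
-- The index is a ratio of covolumes. Both are measured against the fundamental domain of `b₀`,
-- whose finite nonzero volume cancels.
lemma relIndex_span_range_basis [DecidableEq ι] (b₀ b₁ b₂ : Module.Basis ι ℝ E)
    (h : Submodule.span ℤ (Set.range b₁) ≤ Submodule.span ℤ (Set.range b₂)) :
    ((Submodule.span ℤ (Set.range b₁)).toAddSubgroup.relIndex
      (Submodule.span ℤ (Set.range b₂)).toAddSubgroup : ℝ) = |b₀.det b₁| / |b₀.det b₂| := by
  borelize E
  rw [← covolume_div_covolume_eq_relIndex' _ _ h,
    covolume_eq_det_mul_measureReal _ _ (b₁.restrictScalars ℤ) b₀,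
    covolume_eq_det_mul_measureReal _ _ (b₂.restrictScalars ℤ) b₀]
  have hc : ∀ b : Module.Basis ι ℝ E,
      ((↑) : Submodule.span ℤ (Set.range b) → E) ∘ ⇑(b.restrictScalars ℤ) = b := by
    intro b
    ext i
    exact b.restrictScalars_apply ℤ i
  rw [hc, hc]
  refine mul_div_mul_right _ _ ?_
  rw [measureReal_ne_zero_iff
    (Bornology.IsBounded.measure_lt_top (ZSpan.fundamentalDomain_isBounded _)).ne]
  exact ZSpan.measure_fundamentalDomain_ne_zero _

lemma relIndex_span_range_basis_ne_zero (L : Submodule ℤ E) [DiscreteTopology L] [IsZLattice ℝ L]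
    (b : Module.Basis ι ℝ E) (h : Submodule.span ℤ (Set.range b) ≤ L) :
    (Submodule.span ℤ (Set.range b)).toAddSubgroup.relIndex L.toAddSubgroup ≠ 0 := by
  borelize E
  have h1 := ZLattice.covolume_div_covolume_eq_relIndex' _ _ h
  have h2 : ZLattice.covolume (Submodule.span ℤ (Set.range b)) / ZLattice.covolume L ≠ 0 :=
    div_ne_zero (ZLattice.covolume_ne_zero _ _) (ZLattice.covolume_ne_zero _ _)
  rw [h1] at h2
  exact_mod_cast h2

end Index

/-! ### Rhombic lattices inside rectangular and centred rectangular lattices -/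

section Rhombic

variable {E : Type*} [NormedAddCommGroup E] [InnerProductSpace ℝ E] {e f : E}

/-- The lattice spanned by `p e + q f` and `p e - q f`. -/
def rhombicLattice (e f : E) (p q : ℝ) : Submodule ℤ E :=
  Submodule.span ℤ {p • e + q • f, p • e - q • f}

lemma mem_rhombicLattice {p q : ℝ} {x : E} : x ∈ rhombicLattice e f p q ↔
    ∃ m n : ℤ, x = ((m + n) * p) • e + ((m - n) * q) • f := by
  rw [rhombicLattice, Submodule.mem_span_pair]
  refine exists₂_congr fun m n => ?_
  rw [eq_comm, ← Int.cast_smul_eq_zsmul ℝ, ← Int.cast_smul_eq_zsmul ℝ]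
  refine Eq.congr rfl ?_
  module

lemma rhombicLattice_neg_right (p q : ℝ) :
    rhombicLattice e f p (-q) = rhombicLattice e f p q := by
  ext x
  rw [mem_rhombicLattice, mem_rhombicLattice]
  constructor <;> rintro ⟨m, n, rfl⟩ <;> refine ⟨n, m, ?_⟩ <;> module

lemma rhombicLattice_neg_left (p q : ℝ) :
    rhombicLattice e f (-p) q = rhombicLattice e f p q := by
  ext x
  rw [mem_rhombicLattice, mem_rhombicLattice]
  constructor <;> rintro ⟨m, n, rfl⟩ <;> refine ⟨-n, -m, ?_⟩ <;> push_cast <;> module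

lemma rhombicLattice_natAbs (p q : ℤ) :
    rhombicLattice e f (p.natAbs : ℝ) (q.natAbs : ℝ) = rhombicLattice e f p q := by
  rw [Nat.cast_natAbs, Nat.cast_natAbs, Int.cast_abs, Int.cast_abs]
  rcases abs_choice (p : ℝ) with h | h <;> rcases abs_choice (q : ℝ) with h' | h' <;>
    rw [h, h'] <;> simp only [rhombicLattice_neg_left, rhombicLattice_neg_right]

/-- The rhombic lattice with parameters p', q' meets the axes exactly in the multiples of 2p' e and
of 2q' f, so its parameters can be read off. -/
lemma IsOrthogonalFrame.dvd_of_rhombicLattice_le (h : IsOrthogonalFrame e f) {p q p' q' : ℕ}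
    (hq' : 0 < q') (hp' : 0 < p')
    (hle : rhombicLattice e f p q ≤ rhombicLattice e f p' q') : p' ∣ p ∧ q' ∣ q := by
  constructor
  · have h1 : ((2 * p : ℝ)) • e + (0 : ℝ) • f ∈ rhombicLattice e f p' q' :=
      hle (mem_rhombicLattice.2 ⟨1, 1, by push_cast; module⟩)
    obtain ⟨m, n, hmn⟩ := mem_rhombicLattice.1 h1
    obtain ⟨h2, h3⟩ := h.coords_ext hmn
    have hmn' : m = n := by
      have : ((m : ℝ) - n) = 0 := by
        rcases mul_eq_zero.1 h3.symm with h | h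
        · exact h
        · exact absurd h (by positivity)
      exact_mod_cast sub_eq_zero.1 this
    subst hmn'
    refine Int.natCast_dvd_natCast.1 ⟨m, ?_⟩
    have : (p : ℝ) = p' * m := by linarith
    exact_mod_cast this
  · have h1 : (0 : ℝ) • e + ((2 * q : ℝ)) • f ∈ rhombicLattice e f p' q' :=
      hle (mem_rhombicLattice.2 ⟨1, -1, by push_cast; module⟩)
    obtain ⟨m, n, hmn⟩ := mem_rhombicLattice.1 h1
    obtain ⟨h2, h3⟩ := h.coords_ext hmn
    have hmn' : m = -n := by
      have : ((m : ℝ) + n) = 0 := by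
        rcases mul_eq_zero.1 h2.symm with h | h
        · exact h
        · exact absurd h (by positivity)
      exact_mod_cast eq_neg_of_add_eq_zero_left this
    subst hmn'
    refine Int.natCast_dvd_natCast.1 ⟨-n, ?_⟩
    push_cast at h3
    have : (q : ℝ) = q' * (-n) := by linarith
    exact_mod_cast this

lemma IsOrthogonalFrame.rhombicLattice_inj (h : IsOrthogonalFrame e f) {p q p' q' : ℕ}
    (hp : 0 < p) (hq : 0 < q) (hp' : 0 < p') (hq' : 0 < q')
    (heq : rhombicLattice e f p q = rhombicLattice e f p' q') : p = p' ∧ q = q' := by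
  obtain ⟨h1, h2⟩ := h.dvd_of_rhombicLattice_le hq' hp' heq.le
  obtain ⟨h3, h4⟩ := h.dvd_of_rhombicLattice_le hq hp heq.ge
  exact ⟨Nat.dvd_antisymm h3 h1, Nat.dvd_antisymm h4 h2⟩

lemma IsOrthogonalFrame.exists_basis_rhombicLattice (h : IsOrthogonalFrame e f) {p q : ℝ}
    (hp : 0 < p) (hq : 0 < q) : ∃ B : Module.Basis (Fin 2) ℝ E, |h.basis.det B| = 2 * p * q ∧
      rhombicLattice e f p q = Submodule.span ℤ (Set.range B) ∧
      ⇑B = ![p • e + q • f, p • e - q • f] := by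
  have hpq : 0 < p * q := by positivity
  obtain ⟨B, hB⟩ := h.exists_basis (a := p) (b := q) (c := p) (d := -q) (by linarith)
  refine ⟨B, ?_, ?_, ?_⟩
  · rw [hB, h.det_basis, abs_of_nonpos (by linarith)]
    ring
  · rw [hB, Matrix.range_cons, Matrix.range_cons, Matrix.range_empty, Set.union_empty,
      Set.singleton_union, rhombicLattice, neg_smul, sub_eq_add_neg]
  · rw [hB, neg_smul, sub_eq_add_neg]

/-- The lattice `K` consists of the vectors `p e + q f` with `p` and `q` congruent modulo `d`. -/
structure IsCongruenceLattice (K : Submodule ℤ E) (e f : E) (d : ℕ) : Prop where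
  frame : IsOrthogonalFrame e f
  d_eq : d = 1 ∨ d = 2
  mem_iff : ∀ x, x ∈ K ↔ ∃ p q : ℤ, q ≡ p [ZMOD d] ∧ x = (p : ℝ) • e + (q : ℝ) • f

namespace IsCongruenceLattice

variable {K : Submodule ℤ E} {d : ℕ}

lemma d_pos (h : IsCongruenceLattice K e f d) : 0 < d := by
  rcases h.d_eq with h | h <;> omega

lemma coords_mem_iff (h : IsCongruenceLattice K e f d) (p q : ℤ) :
    (p : ℝ) • e + (q : ℝ) • f ∈ K ↔ q ≡ p [ZMOD d] := by
  rw [h.mem_iff]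
  constructor
  · rintro ⟨p', q', h1, h2⟩
    obtain ⟨h3, h4⟩ := h.frame.coords_ext h2
    rw [Int.cast_injective h3, Int.cast_injective h4]
    exact h1
  · exact fun h1 => ⟨p, q, h1, rfl⟩

lemma exists_basis (h : IsCongruenceLattice K e f d) :
    ∃ B : Module.Basis (Fin 2) ℝ E, |h.frame.basis.det B| = d ∧
      K = Submodule.span ℤ (Set.range B) := by
  have hd : (0 : ℝ) < d := by exact_mod_cast h.d_pos
  obtain ⟨B, hB⟩ := h.frame.exists_basis (a := 1) (b := 1) (c := 0) (d := d) (by simp [hd.ne'])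
  refine ⟨B, by rw [hB, h.frame.det_basis]; simp, ?_⟩
  rw [hB, Matrix.range_cons, Matrix.range_cons, Matrix.range_empty, Set.union_empty,
    Set.singleton_union]
  ext x
  rw [Submodule.mem_span_pair, h.mem_iff]
  constructor
  · rintro ⟨p, q, h1, rfl⟩
    obtain ⟨t, ht⟩ := h1.symm.dvd
    refine ⟨p, t, ?_⟩
    have : (q : ℝ) = p + d * t := by
      have : q = p + d * t := by omega
      exact_mod_cast this
    rw [← Int.cast_smul_eq_zsmul ℝ, ← Int.cast_smul_eq_zsmul ℝ, this]
    module
  · rintro ⟨p, t, rfl⟩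
    refine ⟨p, p + d * t, by simp [Int.ModEq], ?_⟩
    rw [← Int.cast_smul_eq_zsmul ℝ, ← Int.cast_smul_eq_zsmul ℝ]
    push_cast
    module

lemma rhombicLattice_le (h : IsCongruenceLattice K e f d) {p q : ℕ} (hpq : q ≡ p [MOD d]) :
    rhombicLattice e f p q ≤ K := by
  have hpq' := Int.natCast_modEq_iff.2 hpq
  rw [rhombicLattice, Submodule.span_le, Set.insert_subset_iff, Set.singleton_subset_iff]
  constructor
  · have := (h.coords_mem_iff p q).2 hpq'
    exact_mod_cast this
  · have := (h.coords_mem_iff p (-q)).2 ?_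
    · rw [Int.cast_neg, neg_smul, ← sub_eq_add_neg] at this
      exact_mod_cast this
    -- Changing the sign of q preserves the congruence because d divides 2.
    · rcases h.d_eq with rfl | rfl
      · simp [Int.modEq_one]
      · unfold Int.ModEq at *
        omega

lemma relIndex_rhombicLattice (h : IsCongruenceLattice K e f d) {p q : ℕ} (hp : 0 < p)
    (hq : 0 < q) (hpq : q ≡ p [MOD d]) :
    (rhombicLattice e f p q).toAddSubgroup.relIndex K.toAddSubgroup = 2 / d * (p * q) := by
  have : FiniteDimensional ℝ E := Module.finite_of_finrank_eq_succ h.frame.finrank_eq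
  obtain ⟨B, hB, hK⟩ := h.exists_basis
  obtain ⟨C, hC, hM, -⟩ := h.frame.exists_basis_rhombicLattice (p := p) (q := q)
    (by exact_mod_cast hp) (by exact_mod_cast hq)
  have hle := h.rhombicLattice_le hpq
  have := relIndex_span_range_basis h.frame.basis C B (by rw [← hK, ← hM]; exact hle)
  rw [← hK, ← hM, hB, hC] at this
  -- Division in ℕ is exact here, as d is 1 or 2.
  have h2 : ((2 / d : ℕ) : ℝ) = 2 / d := by
    rcases h.d_eq with rfl | rfl <;> norm_num
  have h3 : ((rhombicLattice e f p q).toAddSubgroup.relIndex K.toAddSubgroup : ℝ)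
      = ((2 / d * (p * q) : ℕ) : ℝ) := by
    rw [this, Nat.cast_mul, h2]
    push_cast
    ring
  exact_mod_cast h3

lemma relIndex_ne_zero (h : IsCongruenceLattice K e f d) {L : Submodule ℤ E}
    [DiscreteTopology L] [IsZLattice ℝ L] (hK : K ≤ L) :
    K.toAddSubgroup.relIndex L.toAddSubgroup ≠ 0 := by
  have : FiniteDimensional ℝ E := Module.finite_of_finrank_eq_succ h.frame.finrank_eq
  obtain ⟨B, hB, rfl⟩ := h.exists_basis
  exact relIndex_span_range_basis_ne_zero L B hK

end IsCongruenceLattice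

end Rhombic

/-! ### Minimal vectors and well-rounded lattices -/

lemma norm_eq_of_mem_minimalVectors {E : Type*} [NormedAddCommGroup E] {M : Submodule ℤ E}
    {a b : E} (ha : a ∈ minimalVectors M) (hb : b ∈ minimalVectors M) : ‖a‖ = ‖b‖ :=
  le_antisymm (ha.2.2 b hb.1 hb.2.1) (hb.2.2 a ha.1 ha.2.1)

lemma neg_mem_minimalVectors {E : Type*} [NormedAddCommGroup E] {M : Submodule ℤ E} {a : E}
    (ha : a ∈ minimalVectors M) : -a ∈ minimalVectors M :=
  ⟨M.neg_mem ha.1, neg_ne_zero.2 ha.2.1, by simpa using ha.2.2⟩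

section WellRounded

variable {E : Type*} [NormedAddCommGroup E] [InnerProductSpace ℝ E]

lemma norm_zsmul_add_zsmul_sq (a b : E) (m n : ℤ) : ‖m • a + n • b‖ ^ 2
    = (m : ℝ) ^ 2 * ‖a‖ ^ 2 + 2 * (m * n) * inner ℝ a b + (n : ℝ) ^ 2 * ‖b‖ ^ 2 := by
  rw [← Int.cast_smul_eq_zsmul ℝ, ← Int.cast_smul_eq_zsmul ℝ, norm_add_sq_real, norm_smul,
    norm_smul, mul_pow, mul_pow, real_inner_smul_left, real_inner_smul_right, Real.norm_eq_abs,
    Real.norm_eq_abs, sq_abs, sq_abs]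
  ring

/-- The norm form is at least ‖a‖² (m² + n² - |mn|), and the integer in brackets is positive unless
m = n = 0. -/
lemma left_mem_minimalVectors_span_pair {a b : E} (ha : a ≠ 0) (hab : ‖a‖ = ‖b‖)
    (hi : |2 * inner ℝ a b| ≤ ‖a‖ ^ 2) : a ∈ minimalVectors (Submodule.span ℤ {a, b}) := by
  refine ⟨Submodule.subset_span (by simp), ha, ?_⟩
  intro w hw hw0
  obtain ⟨m, n, rfl⟩ := Submodule.mem_span_pair.1 hw
  refine le_of_sq_le_sq ?_ (norm_nonneg _)
  have hmn : (1 : ℤ) ≤ m ^ 2 + n ^ 2 - |m * n| := by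
    have h0 : m ≠ 0 ∨ n ≠ 0 := by
      by_contra! h
      simp [h.1, h.2] at hw0
    have h1 : |m * n| = |m| * |n| := abs_mul m n
    rw [h1, ← sq_abs m, ← sq_abs n]
    have hm := abs_nonneg m
    have hn := abs_nonneg n
    rcases h0 with h | h
    · have := abs_pos.2 h
      rcases le_total |m| |n| with h' | h' <;> nlinarith
    · have := abs_pos.2 h
      rcases le_total |m| |n| with h' | h' <;> nlinarith
  have hmn' : (1 : ℝ) ≤ (m : ℝ) ^ 2 + (n : ℝ) ^ 2 - |(m : ℝ) * n| := by exact_mod_cast hmn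
  rw [norm_zsmul_add_zsmul_sq, ← hab]
  have h2 : |((m : ℝ) * n) * (2 * inner ℝ a b)| ≤ |(m : ℝ) * n| * ‖a‖ ^ 2 := by
    rw [abs_mul]
    gcongr
  have h3 := neg_le_of_abs_le h2
  nlinarith [sq_nonneg ‖a‖]

lemma isWellRounded_span_pair {a b : E} (ha : a ≠ 0) (hab : ‖a‖ = ‖b‖)
    (hi : |2 * inner ℝ a b| ≤ ‖a‖ ^ 2) (hs : Submodule.span ℝ {a, b} = ⊤) :
    IsWellRounded (Submodule.span ℤ {a, b}) := by
  have h1 := left_mem_minimalVectors_span_pair ha hab hi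
  have h2 := left_mem_minimalVectors_span_pair (a := b) (b := a)
    (norm_ne_zero_iff.1 (by rwa [← hab, norm_ne_zero_iff])) hab.symm
    (by rwa [real_inner_comm, ← hab])
  rw [Set.pair_comm] at h2
  rw [IsWellRounded, eq_top_iff, ← hs, Submodule.span_le, Set.insert_subset_iff,
    Set.singleton_subset_iff]
  exact ⟨Submodule.subset_span h1, Submodule.subset_span h2⟩

lemma exists_linearIndependent_minimalVectors (hE : Module.finrank ℝ E = 2) {M : Submodule ℤ E}
    (hM : IsWellRounded M) :
    ∃ a ∈ minimalVectors M, ∃ b ∈ minimalVectors M, LinearIndependent ℝ ![a, b] := by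
  have : FiniteDimensional ℝ E := Module.finite_of_finrank_eq_succ hE
  obtain ⟨a, ha⟩ : (minimalVectors M).Nonempty := by
    by_contra! h
    rw [IsWellRounded, h, Submodule.span_empty] at hM
    have := finrank_top ℝ E
    rw [← hM, finrank_bot, hE] at this
    norm_num at this
  refine ⟨a, ha, ?_⟩
  by_contra! h
  have hle : minimalVectors M ⊆ Submodule.span ℝ {a} := by
    intro b hb
    have := h b hb
    rw [LinearIndependent.pair_iff' ha.2.1] at this
    push Not at this
    exact Submodule.mem_span_singleton.2 this
  have h1 : (⊤ : Submodule ℝ E) ≤ Submodule.span ℝ {a} := by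
    rw [← hM]
    exact Submodule.span_le.2 hle
  have h2 := Submodule.finrank_mono h1
  rw [finrank_top, hE, finrank_span_singleton ha.2.1] at h2
  norm_num at h2

lemma span_pair_eq_top_of_linearIndependent (hE : Module.finrank ℝ E = 2) {a b : E}
    (hab : LinearIndependent ℝ ![a, b]) : Submodule.span ℝ {a, b} = ⊤ := by
  have := hab.span_eq_top_of_card_eq_finrank (by simp [hE])
  rwa [Matrix.range_cons, Matrix.range_cons, Matrix.range_empty, Set.union_empty,
    Set.singleton_union] at this

/-- The squared norm is at most ‖a‖²/2 + |⟨a, b⟩|/2, and Cauchy–Schwarz is strict for independent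
vectors. -/
lemma norm_smul_add_smul_lt {a b : E} (hab : LinearIndependent ℝ ![a, b]) (hn : ‖a‖ = ‖b‖)
    {s t : ℝ} (hs : |s| ≤ 1 / 2) (ht : |t| ≤ 1 / 2) : ‖s • a + t • b‖ < ‖a‖ := by
  have ha : a ≠ 0 := hab.ne_zero 0
  have hpos : 0 < ‖a‖ := norm_pos_iff.2 ha
  have hlt : |inner ℝ a b| < ‖a‖ * ‖a‖ := by
    refine lt_of_le_of_ne ?_ ?_
    · exact (abs_real_inner_le_norm a b).trans_eq (by rw [hn])
    · intro h
      have hb : b ≠ 0 := hab.ne_zero 1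
      nth_rw 2 [hn] at h
      have h1 : |inner ℝ a b / (‖a‖ * ‖b‖)| = 1 := by
        rw [abs_div, h, abs_of_nonneg (by positivity), div_self]
        exact mul_ne_zero (norm_ne_zero_iff.2 ha) (norm_ne_zero_iff.2 hb)
      obtain ⟨-, r, -, hr⟩ := (abs_real_inner_div_norm_mul_norm_eq_one_iff a b).1 h1
      exact (LinearIndependent.pair_iff' ha).1 hab r hr.symm
  refine lt_of_pow_lt_pow_left₀ 2 hpos.le ?_
  rw [norm_add_sq_real, norm_smul, norm_smul, mul_pow, mul_pow, real_inner_smul_left,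
    real_inner_smul_right, Real.norm_eq_abs, Real.norm_eq_abs, ← hn]
  have h1 : 2 * (s * (t * inner ℝ a b)) ≤ 2 * (|s| * (|t| * |inner ℝ a b|)) := by
    rw [← abs_mul, ← abs_mul]
    linarith [le_abs_self (s * (t * inner ℝ a b))]
  have hs0 := abs_nonneg s
  have ht0 := abs_nonneg t
  have h2 : |s| * |t| ≤ 1 / 4 := by nlinarith
  have h3 : |s| * |t| * |inner ℝ a b| ≤ 1 / 4 * |inner ℝ a b| := by gcongr
  have h4 : |s| ^ 2 ≤ 1 / 4 := by nlinarith
  have h5 : |t| ^ 2 ≤ 1 / 4 := by nlinarith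
  have h6 : |s| ^ 2 * ‖a‖ ^ 2 ≤ 1 / 4 * ‖a‖ ^ 2 := by gcongr
  have h7 : |t| ^ 2 * ‖a‖ ^ 2 ≤ 1 / 4 * ‖a‖ ^ 2 := by gcongr
  nlinarith

/-- Rounding real coordinates to integers leaves a remainder in M shorter than the minimum, hence
zero. -/
lemma eq_span_pair_of_mem_minimalVectors (hE : Module.finrank ℝ E = 2) {M : Submodule ℤ E}
    {a b : E} (ha : a ∈ minimalVectors M) (hb : b ∈ minimalVectors M)
    (hab : LinearIndependent ℝ ![a, b]) : M = Submodule.span ℤ {a, b} := by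
  refine le_antisymm ?_ ?_
  · intro x hx
    have hx' : x ∈ Submodule.span ℝ {a, b} := by
      rw [span_pair_eq_top_of_linearIndependent hE hab]
      trivial
    obtain ⟨s, t, rfl⟩ := Submodule.mem_span_pair.1 hx'
    have hrem : s • a + t • b - (round s • a + round t • b)
        = (s - round s) • a + (t - round t) • b := by
      rw [← Int.cast_smul_eq_zsmul ℝ, ← Int.cast_smul_eq_zsmul ℝ]
      module
    have hmem : s • a + t • b - (round s • a + round t • b) ∈ M :=
      M.sub_mem hx (M.add_mem (M.smul_mem _ ha.1) (M.smul_mem _ hb.1))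
    have hlt := norm_smul_add_smul_lt hab (norm_eq_of_mem_minimalVectors ha hb)
      (abs_sub_round s) (abs_sub_round t)
    rw [← hrem] at hlt
    have h0 : s • a + t • b - (round s • a + round t • b) = 0 := by
      by_contra h
      exact absurd (ha.2.2 _ hmem h) (not_le.2 hlt)
    exact Submodule.mem_span_pair.2 ⟨round s, round t, (sub_eq_zero.1 h0).symm⟩
  · rw [Submodule.span_le, Set.insert_subset_iff, Set.singleton_subset_iff]
    exact ⟨ha.1, hb.1⟩

end WellRounded

/-! ### Coincidence reflections and the shape of the coincidence lattice -/

section Coincidence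

variable {E : Type*} [NormedAddCommGroup E] [InnerProductSpace ℝ E]

lemma mem_cslOf_reflection {L : Submodule ℤ E} {U : Submodule ℝ E} [U.HasOrthogonalProjection]
    {x : E} : x ∈ cslOf L U.reflection ↔ x ∈ L ∧ U.reflection x ∈ L := by
  rw [cslOf, Submodule.mem_inf]
  refine and_congr_right fun _ => ?_
  rw [Submodule.mem_map]
  constructor
  · rintro ⟨y, hy, rfl⟩
    simpa using hy
  · exact fun h => ⟨_, h, by simp⟩

lemma IsOrthogonalFrame.cslOf_symm {e f : E} (h : IsOrthogonalFrame e f) (L : Submodule ℤ E) :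
    cslOf L (Submodule.span ℝ {f})ᗮ.reflection = cslOf L (Submodule.span ℝ {e})ᗮ.reflection := by
  ext x
  rw [mem_cslOf_reflection, mem_cslOf_reflection, h.reflection_symm_apply, neg_mem_iff]

/-- The reflection swaps a and b, so both lie in L ∩ RL. Through this lemma a well-rounded
sublattice forces coincidence reflections of L. -/
lemma isCoincidenceIsometry_reflection_sub (hE : Module.finrank ℝ E = 2) {L : Submodule ℤ E}
    {a b : E} (ha : a ∈ L) (hb : b ∈ L) (hn : ‖a‖ = ‖b‖) (hab : LinearIndependent ℝ ![a, b]) :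
    IsCoincidenceIsometry L (Submodule.span ℝ {a - b})ᗮ.reflection := by
  have h1 : (Submodule.span ℝ {a - b})ᗮ.reflection a = b := Submodule.reflection_sub hn
  have h2 : (Submodule.span ℝ {a - b})ᗮ.reflection b = a := by
    have := Submodule.reflection_reflection (Submodule.span ℝ {a - b})ᗮ a
    rwa [h1] at this
  rw [IsCoincidenceIsometry, eq_top_iff, ← span_pair_eq_top_of_linearIndependent hE hab,
    Submodule.span_le, Set.insert_subset_iff, Set.singleton_subset_iff]
  exact ⟨Submodule.subset_span (mem_cslOf_reflection.2 ⟨ha, by rwa [h1]⟩),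
    Submodule.subset_span (mem_cslOf_reflection.2 ⟨hb, by rwa [h2]⟩)⟩

/-- A line through a nonzero vector of a discrete lattice contains a primitive vector. -/
lemma exists_primitive (L : Submodule ℤ E) [DiscreteTopology L] {x : E} (hx : x ∈ L)
    (hx0 : x ≠ 0) : ∃ v : E, v ≠ 0 ∧ v ∈ Submodule.span ℝ {x} ∧
      ∀ t : ℝ, t • v ∈ L ↔ ∃ n : ℤ, t = n := by
  obtain ⟨ε, hε, hball⟩ := Metric.exists_ball_inter_eq_singleton_of_mem_discrete
    (s := (L : Set E)) (DiscreteTopology.isDiscrete (s := (L : Set E))) L.zero_mem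
  have hx' : 0 < ‖x‖ := norm_pos_iff.2 hx0
  let H : AddSubgroup ℝ :=
    L.toAddSubgroup.comap (LinearMap.toSpanSingleton ℝ E x).toAddMonoidHom
  have hH : ∀ t : ℝ, t ∈ H ↔ t • x ∈ L := fun t => Iff.rfl
  -- The scalars t with t x in L form a subgroup of ℝ in which 0 is isolated, hence a cyclic one.
  obtain ⟨b, hb⟩ := AddSubgroup.cyclic_of_isolated_zero (H := H) (a := ε / ‖x‖) (by positivity) (by
    rw [Set.disjoint_left]
    rintro t ht ⟨h1, h2⟩
    have h3 : t • x ∈ Metric.ball (0 : E) ε ∩ (L : Set E) := by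
      refine ⟨?_, ht⟩
      rw [mem_ball_zero_iff, norm_smul, Real.norm_eq_abs, abs_of_pos h1]
      exact (lt_div_iff₀ hx').1 h2
    rw [hball, Set.mem_singleton_iff, smul_eq_zero] at h3
    rcases h3 with h | h
    · exact h1.ne' h
    · exact hx0 h)
  have hmem : ∀ t : ℝ, t • x ∈ L ↔ ∃ n : ℤ, n * b = t := by
    intro t
    rw [← hH, hb, AddSubgroup.mem_closure_singleton]
    simp
  have hb0 : b ≠ 0 := by
    rintro rfl
    obtain ⟨n, hn⟩ := (hmem 1).1 (by simpa using hx)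
    simp at hn
  refine ⟨b • x, smul_ne_zero hb0 hx0, Submodule.smul_mem _ _ (Submodule.mem_span_singleton_self x),
    fun t => ?_⟩
  rw [smul_smul, hmem]
  refine exists_congr fun n => ?_
  rw [mul_left_inj' hb0, eq_comm]

/-- For y in the coincidence lattice, y - Ry is a point of L on the line of u. If all of these
vanished, the coincidence lattice would lie in the orthogonal line, against full rank. The
orthogonal line is treated alike, since -R has the same coincidence lattice. -/
lemma exists_primitive_frame (hE : Module.finrank ℝ E = 2) (L : Submodule ℤ E)
    [DiscreteTopology L] {u : E} (hu : u ≠ 0)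
    (hc : IsCoincidenceIsometry L (Submodule.span ℝ {u})ᗮ.reflection) :
    ∃ v w : E, IsOrthogonalFrame v w ∧ v ∈ Submodule.span ℝ {u} ∧
      (∀ t : ℝ, t • v ∈ L ↔ ∃ n : ℤ, t = n) ∧ (∀ t : ℝ, t • w ∈ L ↔ ∃ n : ℤ, t = n) := by
  have hmain : ∀ u u' : E, IsOrthogonalFrame u u' →
      IsCoincidenceIsometry L (Submodule.span ℝ {u})ᗮ.reflection →
      ∃ v : E, v ≠ 0 ∧ v ∈ Submodule.span ℝ {u} ∧ ∀ t : ℝ, t • v ∈ L ↔ ∃ n : ℤ, t = n := by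
    intro u u' h hc
    obtain ⟨x, hxL, hx0, hxu⟩ : ∃ x ∈ L, x ≠ 0 ∧ x ∈ Submodule.span ℝ {u} := by
      by_contra! hno
      have hle : (cslOf L (Submodule.span ℝ {u})ᗮ.reflection : Set E)
          ⊆ (Submodule.span ℝ {u})ᗮ := by
        intro y hy
        obtain ⟨h1, h2⟩ := mem_cslOf_reflection.1 hy
        obtain ⟨a, b, rfl⟩ := h.exists_coords y
        rw [h.reflection_coords] at h2
        have h3 : a • u + b • u' - (-(a • u) + b • u') = (2 * a) • u := by module
        have h4 := L.sub_mem h1 h2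
        rw [h3] at h4
        have h5 : (2 * a) • u = 0 := by
          by_contra h5
          exact hno _ h4 h5 (Submodule.smul_mem _ _ (Submodule.mem_span_singleton_self u))
        have h6 : a = 0 := by
          rcases smul_eq_zero.1 h5 with h6 | h6
          · linarith
          · exact absurd h6 h.left_ne
        rw [h6, zero_smul, zero_add]
        exact Submodule.smul_mem _ _
          (Submodule.mem_orthogonal_singleton_iff_inner_right.2 h.inner_eq)
      have h7 : u ∈ (Submodule.span ℝ {u})ᗮ := by
        have := Submodule.span_le.2 hle
        rw [hc] at this
        exact this trivial
      rw [Submodule.mem_orthogonal_singleton_iff_inner_right, inner_self_eq_zero] at h7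
      exact h.left_ne h7
    obtain ⟨v, hv0, hvx, hv⟩ := exists_primitive L hxL hx0
    exact ⟨v, hv0, by rwa [← span_singleton_eq_of_mem hx0 hxu], hv⟩
  obtain ⟨u', h⟩ := exists_isOrthogonalFrame hE hu
  obtain ⟨v, hv0, hvu, hv⟩ := hmain u u' h hc
  obtain ⟨w, hw0, hwu, hw⟩ := hmain u' u h.symm (by
    rw [IsCoincidenceIsometry, h.cslOf_symm]
    exact hc)
  refine ⟨v, w, ⟨hv0, hw0, ?_, hE⟩, hvu, hv, hw⟩
  obtain ⟨s, rfl⟩ := Submodule.mem_span_singleton.1 hvu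
  obtain ⟨t, rfl⟩ := Submodule.mem_span_singleton.1 hwu
  rw [inner_smul_left, inner_smul_right, h.inner_eq]
  simp

/-- For x in K the vectors x ± Rx lie in L on the axes, so x has half-integral coordinates in the
primitive frame v, w. By primitivity, v/2 and w/2 cannot occur modulo integral combinations; only
the centre (v + w)/2 can, and its membership in L decides between d = 2 and d = 1. -/
lemma exists_isCongruenceLattice_cslOf (hE : Module.finrank ℝ E = 2) (L : Submodule ℤ E)
    [DiscreteTopology L] {u : E} (hu : u ≠ 0)
    (hc : IsCoincidenceIsometry L (Submodule.span ℝ {u})ᗮ.reflection) :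
    ∃ (e f : E) (d : ℕ), Submodule.span ℝ {e} = Submodule.span ℝ {u} ∧
      IsCongruenceLattice (cslOf L (Submodule.span ℝ {u})ᗮ.reflection) e f d := by
  obtain ⟨v, w, h, hvu, hv, hw⟩ := exists_primitive_frame hE L hu hc
  have hspan := span_singleton_eq_of_mem h.left_ne hvu
  have hv' : ∀ n : ℤ, (n : ℝ) • v ∈ L := fun n => (hv n).2 ⟨n, rfl⟩
  have hw' : ∀ n : ℤ, (n : ℝ) • w ∈ L := fun n => (hw n).2 ⟨n, rfl⟩
  have hcsl : ∀ a b : ℝ, a • v + b • w ∈ cslOf L (Submodule.span ℝ {u})ᗮ.reflection ↔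
      a • v + b • w ∈ L ∧ -(a • v) + b • w ∈ L := by
    intro a b
    rw [mem_cslOf_reflection]
    have := h.reflection_coords a b
    simp only [hspan] at this
    rw [this]
  have hdouble : ∀ a b : ℝ, a • v + b • w ∈ L → -(a • v) + b • w ∈ L →
      ∃ m n : ℤ, a = m / 2 ∧ b = n / 2 := by
    intro a b h1 h2
    have h3 := L.sub_mem h1 h2
    have h4 := L.add_mem h1 h2
    rw [show a • v + b • w - (-(a • v) + b • w) = (2 * a) • v by module] at h3
    rw [show a • v + b • w + (-(a • v) + b • w) = (2 * b) • w by module] at h4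
    obtain ⟨m, hm⟩ := (hv _).1 h3
    obtain ⟨n, hn⟩ := (hw _).1 h4
    exact ⟨m, n, by linarith, by linarith⟩
  by_cases hcen : (1 / 2 : ℝ) • v + (1 / 2 : ℝ) • w ∈ L
  -- With the frame halved, adjoining the centre amounts to equal parity of the coordinates.
  · refine ⟨(1 / 2 : ℝ) • v, (1 / 2 : ℝ) • w, 2, ?_, h.smul (by norm_num) (by norm_num),
      Or.inr rfl, fun x => ?_⟩
    · rw [← hspan]
      exact Submodule.span_singleton_smul_eq (isUnit_iff_ne_zero.2 (by norm_num)) v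
    · constructor
      · intro hx
        obtain ⟨a, b, rfl⟩ := h.exists_coords x
        obtain ⟨h1, h2⟩ := (hcsl a b).1 hx
        obtain ⟨m, n, rfl, rfl⟩ := hdouble a b h1 h2
        refine ⟨m, n, ?_, by module⟩
        have h3 := L.sub_mem h1 (L.smul_mem n hcen)
        rw [← Int.cast_smul_eq_zsmul ℝ, show ((m : ℝ) / 2) • v + ((n : ℝ) / 2) • w
          - (n : ℝ) • ((1 / 2 : ℝ) • v + (1 / 2 : ℝ) • w) = (((m : ℝ) - n) / 2) • v by module,
          hv] at h3
        obtain ⟨k, hk⟩ := h3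
        have : m - n = 2 * k := by
          have : (m : ℝ) - n = 2 * k := by linarith
          exact_mod_cast this
        unfold Int.ModEq
        omega
      · rintro ⟨p, q, hpq, rfl⟩
        obtain ⟨k, hk⟩ := hpq.dvd
        have hk' : (p : ℝ) = q + 2 * k := by
          have : p = q + 2 * k := by push_cast at hk; omega
          exact_mod_cast this
        rw [smul_smul, smul_smul, hcsl, hk']
        have h3 : (q : ℝ) • ((1 / 2 : ℝ) • v + (1 / 2 : ℝ) • w) ∈ L := by
          rw [Int.cast_smul_eq_zsmul]
          exact L.smul_mem _ hcen
        constructor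
        · convert L.add_mem h3 (hv' k) using 1
          module
        · convert L.sub_mem h3 (hv' (q + k)) using 1
          push_cast
          module
  · refine ⟨v, w, 1, hspan, h, Or.inl rfl, fun x => ?_⟩
    constructor
    · intro hx
      obtain ⟨a, b, rfl⟩ := h.exists_coords x
      obtain ⟨h1, h2⟩ := (hcsl a b).1 hx
      obtain ⟨m, n, rfl, rfl⟩ := hdouble a b h1 h2
      rcases Int.even_or_odd' m with ⟨k, rfl | rfl⟩
      · have h3 := L.sub_mem h1 (hv' k)
        rw [show (((2 * k : ℤ) : ℝ) / 2) • v + ((n : ℝ) / 2) • w - (k : ℝ) • v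
          = ((n : ℝ) / 2) • w by push_cast; module, hw] at h3
        obtain ⟨l, hl⟩ := h3
        exact ⟨k, l, by simp [Int.modEq_one], by rw [hl]; push_cast; module⟩
      -- An odd m is impossible: n even contradicts primitivity of v, and n odd puts the centre into
      -- L.
      · exfalso
        rcases Int.even_or_odd' n with ⟨l, rfl | rfl⟩
        · have h3 := L.sub_mem h1 (hw' l)
          rw [show (((2 * k + 1 : ℤ) : ℝ) / 2) • v + (((2 * l : ℤ) : ℝ) / 2) • w - (l : ℝ) • w
            = (((2 * k + 1 : ℤ) : ℝ) / 2) • v by push_cast; module, hv] at h3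
          obtain ⟨j, hj⟩ := h3
          have : (2 * k + 1 : ℤ) = 2 * j := by
            have : ((2 * k + 1 : ℤ) : ℝ) = 2 * j := by linarith
            exact_mod_cast this
          omega
        · refine hcen ?_
          have h3 := L.sub_mem (L.sub_mem h1 (hw' l)) (hv' k)
          convert h3 using 1
          push_cast
          module
    · rintro ⟨p, q, -, rfl⟩
      rw [hcsl]
      refine ⟨L.add_mem (hv' p) (hw' q), L.add_mem (L.neg_mem (hv' p)) (hw' q)⟩

end Coincidence

/-- Coordinates of the rhombic sublattices that are well-rounded. -/
def wellRoundedCoords {E : Type*} [NormedAddCommGroup E] (e f : E) (d : ℕ) : Set (ℕ × ℕ) :=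
  {z | 0 < z.1 ∧ 0 < z.2 ∧ z.2 ≡ z.1 [MOD d] ∧
    (z.1 : ℝ) ^ 2 * ‖e‖ ^ 2 ≤ 3 * ((z.2 : ℝ) ^ 2 * ‖f‖ ^ 2) ∧
    (z.2 : ℝ) ^ 2 * ‖f‖ ^ 2 ≤ 3 * ((z.1 : ℝ) ^ 2 * ‖e‖ ^ 2)}

/-- Taking square roots turns the two length inequalities into slopes r and 3r with r = ‖e‖ / (√3
‖f‖); the index bound becomes the hyperbola. -/
lemma mem_sectorPairs_iff {E : Type*} [NormedAddCommGroup E] {e f : E} {d : ℕ} (he : e ≠ 0)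
    (hf : f ≠ 0) (hd : d = 1 ∨ d = 2) {σ : ℕ}
    (hσ : 0 < σ) (x : ℝ) (z : ℕ × ℕ) :
    z ∈ sectorPairs d (‖e‖ / (√3 * ‖f‖)) (d * x / (2 * σ)) ↔
      z ∈ wellRoundedCoords e f d ∧ ((2 / d * (z.1 * z.2) * σ : ℕ) : ℝ) ≤ x := by
  have he' : 0 < ‖e‖ := norm_pos_iff.2 he
  have hf' : 0 < ‖f‖ := norm_pos_iff.2 hf
  have hσ' : (0 : ℝ) < σ := by exact_mod_cast hσ
  have s0 : 0 < √3 := by positivity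
  have s3 : √3 ^ 2 = 3 := Real.sq_sqrt (by norm_num)
  have hd' : (0 : ℝ) < d := by rcases hd with rfl | rfl <;> norm_num
  have h2 : ((2 / d : ℕ) : ℝ) = 2 / d := by rcases hd with rfl | rfl <;> norm_num
  have k1 : ‖e‖ / (√3 * ‖f‖) * z.1 ≤ z.2 ↔
      (z.1 : ℝ) ^ 2 * ‖e‖ ^ 2 ≤ 3 * ((z.2 : ℝ) ^ 2 * ‖f‖ ^ 2) := by
    rw [div_mul_eq_mul_div, div_le_iff₀ (by positivity),
      ← sq_le_sq₀ (by positivity) (by positivity)]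
    simp only [mul_pow, s3]
    constructor <;> intro h <;> linarith
  have k2 : (z.2 : ℝ) ≤ 3 * (‖e‖ / (√3 * ‖f‖)) * z.1 ↔
      (z.2 : ℝ) ^ 2 * ‖f‖ ^ 2 ≤ 3 * ((z.1 : ℝ) ^ 2 * ‖e‖ ^ 2) := by
    have : 3 * (‖e‖ / (√3 * ‖f‖)) * z.1 = √3 * ‖e‖ * z.1 / ‖f‖ := by
      field_simp
      rw [s3]
    rw [this, le_div_iff₀ hf', ← sq_le_sq₀ (by positivity) (by positivity)]
    simp only [mul_pow, s3]
    constructor <;> intro h <;> linarith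
  have k3 : (z.1 * z.2 : ℝ) ≤ d * x / (2 * σ) ↔ ((2 / d * (z.1 * z.2) * σ : ℕ) : ℝ) ≤ x := by
    push_cast
    rw [h2, le_div_iff₀ (by positivity), div_mul_eq_mul_div, div_mul_eq_mul_div, div_le_iff₀ hd']
    constructor <;> intro h <;> linarith
  simp only [sectorPairs, wellRoundedCoords, Set.mem_ofPred_eq, k1, k2, k3, and_assoc]

/-! ### Classification and count of the well-rounded sublattices -/

section Classification

variable {E : Type*} [NormedAddCommGroup E] [InnerProductSpace ℝ E] {e f : E} {d : ℕ}
  {L : Submodule ℤ E}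

/-- The reflection negating e sends a to -b, which is in L, so a belongs to the coincidence lattice.
-/
lemma IsCongruenceLattice.exists_rhombic_coords
    (h : IsCongruenceLattice (cslOf L (Submodule.span ℝ {e})ᗮ.reflection) e f d) {a b : E}
    (ha : a ∈ L) (hb : b ∈ L) (hadd : a + b ∈ Submodule.span ℝ {e})
    (hsub : a - b ∈ Submodule.span ℝ {f}) : ∃ p q : ℤ, q ≡ p [ZMOD d] ∧
      a = (p : ℝ) • e + (q : ℝ) • f ∧ b = (p : ℝ) • e - (q : ℝ) • f := by
  obtain ⟨s, hs⟩ := Submodule.mem_span_singleton.1 hadd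
  obtain ⟨t, ht⟩ := Submodule.mem_span_singleton.1 hsub
  have ha' : a = (s / 2) • e + (t / 2) • f := by
    have : a = (1 / 2 : ℝ) • ((a + b) + (a - b)) := by module
    rw [this, ← hs, ← ht]
    module
  have hb' : b = (s / 2) • e - (t / 2) • f := by
    have : b = (1 / 2 : ℝ) • ((a + b) - (a - b)) := by module
    rw [this, ← hs, ← ht]
    module
  have hmem : a ∈ cslOf L (Submodule.span ℝ {e})ᗮ.reflection := by
    refine mem_cslOf_reflection.2 ⟨ha, ?_⟩
    rw [ha', h.frame.reflection_coords]
    convert L.neg_mem hb using 1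
    rw [hb']
    module
  obtain ⟨p, q, hpq, hac⟩ := (h.mem_iff a).1 hmem
  obtain ⟨h1, h2⟩ := h.frame.coords_ext (ha'.symm.trans hac)
  exact ⟨p, q, hpq, hac, by rw [hb', h1, h2]⟩

lemma Int.ModEq.natAbs_of_eq_one_or_two {p q : ℤ} (hd : d = 1 ∨ d = 2) (h : q ≡ p [ZMOD d]) :
    q.natAbs ≡ p.natAbs [MOD d] := by
  rcases hd with rfl | rfl
  · exact Nat.modEq_one
  · unfold Int.ModEq at h
    unfold Nat.ModEq
    omega

lemma IsCongruenceLattice.exists_wellRoundedCoords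
    (h : IsCongruenceLattice (cslOf L (Submodule.span ℝ {e})ᗮ.reflection) e f d)
    {M : Submodule ℤ E} (hM : M ≤ L) {a b : E} (ha : a ∈ minimalVectors M)
    (hb : b ∈ minimalVectors M) (hab : LinearIndependent ℝ ![a, b])
    (hadd : a + b ∈ Submodule.span ℝ {e}) (hsub : a - b ∈ Submodule.span ℝ {f}) :
    ∃ z ∈ wellRoundedCoords e f d, M = rhombicLattice e f z.1 z.2 := by
  obtain ⟨p, q, hpq, rfl, rfl⟩ := h.exists_rhombic_coords (hM ha.1) (hM hb.1) hadd hsub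
  have hli := LinearIndependent.pair_iff.1 hab
  have hp : p ≠ 0 := by
    rintro rfl
    have := hli 1 1 (by simp)
    simp at this
  have hq : q ≠ 0 := by
    rintro rfl
    have := hli 1 (-1) (by simp)
    simp at this
  have h1 : (2 * (p : ℝ)) • e + (0 : ℝ) • f ∈ M := by
    convert M.add_mem ha.1 hb.1 using 1
    module
  have h2 : (0 : ℝ) • e + (2 * (q : ℝ)) • f ∈ M := by
    convert M.sub_mem ha.1 hb.1 using 1
    module
  have hp' : (p : ℝ) ≠ 0 := by exact_mod_cast hp
  have hq' : (q : ℝ) ≠ 0 := by exact_mod_cast hq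
  -- Minimality of a tested on a + b = 2p e and a - b = 2q f gives the two sector inequalities.
  have h3 := ha.2.2 _ h1 (by simp [hp', h.frame.left_ne])
  have h4 := ha.2.2 _ h2 (by simp [hq', h.frame.right_ne])
  have h5 := pow_le_pow_left₀ (norm_nonneg _) h3 2
  have h6 := pow_le_pow_left₀ (norm_nonneg _) h4 2
  rw [h.frame.norm_sq_coords, h.frame.norm_sq_coords] at h5 h6
  have hpa : ((p.natAbs : ℕ) : ℝ) ^ 2 = (p : ℝ) ^ 2 := by
    rw [Nat.cast_natAbs, Int.cast_abs, sq_abs]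
  have hqa : ((q.natAbs : ℕ) : ℝ) ^ 2 = (q : ℝ) ^ 2 := by
    rw [Nat.cast_natAbs, Int.cast_abs, sq_abs]
  refine ⟨(p.natAbs, q.natAbs), ⟨Int.natAbs_pos.2 hp, Int.natAbs_pos.2 hq,
    hpq.natAbs_of_eq_one_or_two h.d_eq, ?_, ?_⟩, ?_⟩
  · rw [hpa, hqa]
    linarith
  · rw [hpa, hqa]
    linarith
  · rw [rhombicLattice_natAbs]
    exact eq_span_pair_of_mem_minimalVectors h.frame.finrank_eq ha hb hab

lemma IsCongruenceLattice.exists_eq_rhombicLattice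
    (h : IsCongruenceLattice (cslOf L (Submodule.span ℝ {e})ᗮ.reflection) e f d)
    (haxis : ∀ u : E, u ≠ 0 → IsCoincidenceIsometry L (Submodule.span ℝ {u})ᗮ.reflection →
      u ∈ Submodule.span ℝ {e} ∨ u ∈ Submodule.span ℝ {f})
    {M : Submodule ℤ E} (hM : M ≤ L) (hw : IsWellRounded M) :
    ∃ z ∈ wellRoundedCoords e f d, M = rhombicLattice e f z.1 z.2 := by
  have hE := h.frame.finrank_eq
  obtain ⟨a, ha, b, hb, hab⟩ := exists_linearIndependent_minimalVectors hE hw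
  have hnb := neg_mem_minimalVectors hb
  have hanb : LinearIndependent ℝ ![a, -b] := by
    rw [LinearIndependent.pair_iff] at hab ⊢
    intro s t hst
    have := hab s (-t) (by rw [← hst]; module)
    exact ⟨this.1, neg_eq_zero.1 this.2⟩
  have hli := LinearIndependent.pair_iff.1 hab
  have hsub0 : a - b ≠ 0 := by
    intro h0
    have := hli 1 (-1) (by rw [← h0]; module)
    simp at this
  have hadd0 : a + b ≠ 0 := by
    intro h0
    have := hli 1 1 (by rw [← h0]; module)
    simp at this
  have h1 := haxis _ hsub0 (isCoincidenceIsometry_reflection_sub hE (hM ha.1) (hM hb.1)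
    (norm_eq_of_mem_minimalVectors ha hb) hab)
  have h2 := isCoincidenceIsometry_reflection_sub hE (hM ha.1) (hM hnb.1)
    (norm_eq_of_mem_minimalVectors ha hnb) hanb
  simp only [sub_neg_eq_add] at h2
  replace h2 := haxis _ hadd0 h2
  have hpar : ∀ g : E, g ≠ 0 → a - b ∈ Submodule.span ℝ {g} → a + b ∉ Submodule.span ℝ {g} := by
    intro g hg h3 h4
    obtain ⟨s, hs⟩ := Submodule.mem_span_singleton.1 h3
    obtain ⟨t, ht⟩ := Submodule.mem_span_singleton.1 h4
    have h5 : (t - s) • a + (-(t + s)) • b = 0 := by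
      have : (t - s) • a + (-(t + s)) • b = t • (a - b) - s • (a + b) := by module
      rw [this, ← hs, ← ht]
      module
    obtain ⟨h6, h7⟩ := hli _ _ h5
    have ht0 : t = 0 := by linarith
    rw [ht0, zero_smul] at ht
    exact hadd0 ht.symm
  -- The vectors a - b and a + b are not parallel, so they lie on different axes; replacing b by -b
  -- exchanges their roles.
  rcases h1 with h1 | h1 <;> rcases h2 with h2 | h2
  · exact absurd h2 (hpar e h.frame.left_ne h1)
  · exact h.exists_wellRoundedCoords hM ha hnb hanb (by rwa [← sub_eq_add_neg])
      (by rwa [sub_neg_eq_add])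
  · exact h.exists_wellRoundedCoords hM ha hb hab h2 h1
  · exact absurd h2 (hpar f h.frame.right_ne h1)

lemma IsOrthogonalFrame.isWellRounded_rhombicLattice (h : IsOrthogonalFrame e f) {z : ℕ × ℕ}
    (hz : z ∈ wellRoundedCoords e f d) : IsWellRounded (rhombicLattice e f z.1 z.2) := by
  obtain ⟨hp, hq, -, h1, h2⟩ := hz
  have hp' : (0 : ℝ) < z.1 := by exact_mod_cast hp
  have hq' : (0 : ℝ) < z.2 := by exact_mod_cast hq
  obtain ⟨B, -, -, hB⟩ := h.exists_basis_rhombicLattice hp' hq'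
  have hsum : ‖(z.1 : ℝ) • e + (z.2 : ℝ) • f‖ ^ 2
      = (z.1 : ℝ) ^ 2 * ‖e‖ ^ 2 + (z.2 : ℝ) ^ 2 * ‖f‖ ^ 2 := h.norm_sq_coords _ _
  have hdiff : ‖(z.1 : ℝ) • e - (z.2 : ℝ) • f‖ ^ 2
      = (z.1 : ℝ) ^ 2 * ‖e‖ ^ 2 + (z.2 : ℝ) ^ 2 * ‖f‖ ^ 2 := by
    rw [sub_eq_add_neg, ← neg_smul, h.norm_sq_coords]
    ring
  refine isWellRounded_span_pair ?_ ?_ ?_ ?_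
  · have := B.ne_zero 0
    rwa [hB] at this
  · rw [← sq_eq_sq₀ (norm_nonneg _) (norm_nonneg _), hsum, hdiff]
  -- The inner product of the generators is p²‖e‖² - q²‖f‖², so the condition unfolds to the two
  -- sector inequalities.
  · rw [hsum, sub_eq_add_neg, ← neg_smul, h.inner_coords, abs_le]
    constructor <;> linarith
  · refine span_pair_eq_top_of_linearIndependent h.finrank_eq ?_
    rw [← hB]
    exact B.linearIndependent

lemma IsCongruenceLattice.wellRoundedSublattices_eq
    (h : IsCongruenceLattice (cslOf L (Submodule.span ℝ {e})ᗮ.reflection) e f d)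
    (haxis : ∀ u : E, u ≠ 0 → IsCoincidenceIsometry L (Submodule.span ℝ {u})ᗮ.reflection →
      u ∈ Submodule.span ℝ {e} ∨ u ∈ Submodule.span ℝ {f}) (n : ℕ) :
    wellRoundedSublattices L n = (fun z : ℕ × ℕ => rhombicLattice e f z.1 z.2) ''
      {z | z ∈ wellRoundedCoords e f d ∧
        2 / d * (z.1 * z.2) * coincidenceIndex L (Submodule.span ℝ {e})ᗮ.reflection = n} := by
  have hKL : cslOf L (Submodule.span ℝ {e})ᗮ.reflection ≤ L := inf_le_left
  have hindex : ∀ z ∈ wellRoundedCoords e f d, latticeIndex L (rhombicLattice e f z.1 z.2)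
      = 2 / d * (z.1 * z.2) * coincidenceIndex L (Submodule.span ℝ {e})ᗮ.reflection := by
    rintro z ⟨hp, hq, hpq, -⟩
    rw [coincidenceIndex, latticeIndex, latticeIndex, ← h.relIndex_rhombicLattice hp hq hpq]
    exact (AddSubgroup.relIndex_mul_relIndex _ _ _ (h.rhombicLattice_le hpq) hKL).symm
  ext M
  constructor
  · rintro ⟨hM, hn, hw⟩
    obtain ⟨z, hz, rfl⟩ := h.exists_eq_rhombicLattice haxis hM hw
    exact ⟨z, ⟨hz, by rw [← hindex z hz, hn]⟩, rfl⟩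
  · rintro ⟨z, ⟨hz, hn⟩, rfl⟩
    exact ⟨(h.rhombicLattice_le hz.2.2.1).trans hKL, by rw [← hn]; exact hindex z hz,
      h.frame.isWellRounded_rhombicLattice hz⟩

lemma IsOrthogonalFrame.injOn_rhombicLattice (h : IsOrthogonalFrame e f) :
    Set.InjOn (fun z : ℕ × ℕ => rhombicLattice e f z.1 z.2) (wellRoundedCoords e f d) := by
  intro z hz z' hz' heq
  obtain ⟨h1, h2⟩ := h.rhombicLattice_inj hz.1 hz.2.1 hz'.1 hz'.2.1 heq
  exact Prod.ext h1 h2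

lemma finite_sectorPairs (d : ℕ) (r y : ℝ) : (sectorPairs d r y).Finite := by
  refine (Set.finite_Iic (⌊y⌋₊, ⌊y⌋₊)).subset ?_
  rintro ⟨p, q⟩ ⟨hp, hq, -, -, -, h⟩
  have h' : p * q ≤ ⌊y⌋₊ := Nat.le_floor (by exact_mod_cast h)
  exact ⟨(Nat.le_mul_of_pos_right p hq).trans h', (Nat.le_mul_of_pos_left q hp).trans h'⟩

lemma IsCongruenceLattice.wellRoundedCount_eq
    (h : IsCongruenceLattice (cslOf L (Submodule.span ℝ {e})ᗮ.reflection) e f d)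
    (haxis : ∀ u : E, u ≠ 0 → IsCoincidenceIsometry L (Submodule.span ℝ {u})ᗮ.reflection →
      u ∈ Submodule.span ℝ {e} ∨ u ∈ Submodule.span ℝ {f})
    {σ : ℕ} (hσ : 0 < σ) (hindex : coincidenceIndex L (Submodule.span ℝ {e})ᗮ.reflection = σ)
    {x : ℝ} (hx : 0 ≤ x) :
    wellRoundedCount L x
      = (sectorPairs d (‖e‖ / (√3 * ‖f‖)) (d * x / (2 * σ))).ncard := by
  have hmem := mem_sectorPairs_iff h.frame.left_ne h.frame.right_ne h.d_eq hσ x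
  have hfin := finite_sectorPairs d (‖e‖ / (√3 * ‖f‖)) (d * x / (2 * σ))
  have hd2 : 0 < 2 / d := by rcases h.d_eq with h | h <;> rw [h] <;> norm_num
  rw [wellRoundedCount, Set.ncard_eq_toFinset_card _ hfin,
    Finset.card_eq_sum_card_fiberwise (f := fun z : ℕ × ℕ => 2 / d * (z.1 * z.2) * σ)
      (t := Finset.Icc 1 ⌊x⌋₊)]
  · refine Finset.sum_congr rfl fun n hn => ?_
    rw [h.wellRoundedSublattices_eq haxis, hindex,
      (h.frame.injOn_rhombicLattice.mono fun z hz => hz.1).ncard_image,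
      ← Set.ncard_coe_finset]
    congr 1
    ext z
    simp only [Finset.coe_filter, Set.Finite.mem_toFinset, Set.mem_ofPred_eq, hmem]
    constructor
    · rintro ⟨hz, hzn⟩
      refine ⟨⟨hz, ?_⟩, hzn⟩
      rw [hzn]
      exact (Nat.le_floor_iff hx).1 (Finset.mem_Icc.1 hn).2
    · rintro ⟨⟨hz, -⟩, hzn⟩
      exact ⟨hz, hzn⟩
  · intro z hz
    rw [Finset.mem_coe, Set.Finite.mem_toFinset, hmem] at hz
    rw [Finset.mem_coe, Finset.mem_Icc]
    exact ⟨Nat.mul_pos (Nat.mul_pos hd2 (Nat.mul_pos hz.1.1 hz.1.2.1)) hσ, Nat.le_floor hz.2⟩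

lemma IsCongruenceLattice.finite_wellRoundedSublattices
    (h : IsCongruenceLattice (cslOf L (Submodule.span ℝ {e})ᗮ.reflection) e f d)
    (haxis : ∀ u : E, u ≠ 0 → IsCoincidenceIsometry L (Submodule.span ℝ {u})ᗮ.reflection →
      u ∈ Submodule.span ℝ {e} ∨ u ∈ Submodule.span ℝ {f})
    (hσ : 0 < coincidenceIndex L (Submodule.span ℝ {e})ᗮ.reflection) (n : ℕ) :
    (wellRoundedSublattices L n).Finite := by
  rw [h.wellRoundedSublattices_eq haxis]
  refine Set.Finite.image _ ((finite_sectorPairs d (‖e‖ / (√3 * ‖f‖)) (d * (n : ℝ) /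
    (2 * coincidenceIndex L (Submodule.span ℝ {e})ᗮ.reflection))).subset ?_)
  rintro z ⟨hz, hn⟩
  rw [mem_sectorPairs_iff h.frame.left_ne h.frame.right_ne h.d_eq hσ]
  exact ⟨hz, by exact_mod_cast hn.le⟩

/-- Substituting y = d x / (2σ) gives log 3 / (2d) · d / (2σ) = log 3 / (4σ): the shape of K and the
ratio ‖e‖ / ‖f‖ affect only the error term. -/
lemma IsCongruenceLattice.wellRoundedCount_isBigO
    (h : IsCongruenceLattice (cslOf L (Submodule.span ℝ {e})ᗮ.reflection) e f d)
    (haxis : ∀ u : E, u ≠ 0 → IsCoincidenceIsometry L (Submodule.span ℝ {u})ᗮ.reflection →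
      u ∈ Submodule.span ℝ {e} ∨ u ∈ Submodule.span ℝ {f})
    {σ : ℕ} (hσ : 0 < σ) (hindex : coincidenceIndex L (Submodule.span ℝ {e})ᗮ.reflection = σ) :
    (fun x : ℝ => (wellRoundedCount L x : ℝ) - Real.log 3 / (4 * (σ : ℝ)) * x)
      =O[atTop] (fun x : ℝ => √x) := by
  have he : 0 < ‖e‖ := norm_pos_iff.2 h.frame.left_ne
  have hf : 0 < ‖f‖ := norm_pos_iff.2 h.frame.right_ne
  have hd : (0 : ℝ) < d := by exact_mod_cast h.d_pos
  have hσ' : (0 : ℝ) < σ := by exact_mod_cast hσ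
  have hc : 0 < (d : ℝ) / (2 * σ) := by positivity
  have htend : Tendsto (fun x : ℝ => (d : ℝ) / (2 * σ) * x) atTop atTop :=
    tendsto_id.const_mul_atTop hc
  have h1 := (ncard_sectorPairs_isBigO h.d_pos
    (r := ‖e‖ / (√3 * ‖f‖)) (by positivity)).comp_tendsto htend
  have h2 : ((fun y : ℝ => √y) ∘ fun x : ℝ => (d : ℝ) / (2 * σ) * x)
      =O[atTop] (fun x : ℝ => √x) := by
    have : ((fun y : ℝ => √y) ∘ fun x : ℝ => (d : ℝ) / (2 * σ) * x)
        = fun x : ℝ => √((d : ℝ) / (2 * σ)) * √x := by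
      ext x
      exact Real.sqrt_mul hc.le x
    rw [this]
    exact isBigO_const_mul_self _ _ _
  refine (h1.trans h2).congr' ?_ EventuallyEq.rfl
  filter_upwards [eventually_ge_atTop 0] with x hx
  rw [h.wellRoundedCount_eq haxis hσ hindex hx, Function.comp_apply, div_mul_eq_mul_div]
  congr 1
  field_simp
  ring

end Classification

theorem theorem6 (L : Submodule ℤ (EuclideanSpace ℝ (Fin 2)))
    [DiscreteTopology L] [IsZLattice ℝ L]
    (h2 : {R : EuclideanSpace ℝ (Fin 2) ≃ₗᵢ[ℝ] EuclideanSpace ℝ (Fin 2) |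
      IsCoincidenceReflection L R}.encard = 2) :
    (∀ n : ℕ, 1 ≤ n → (wellRoundedSublattices L n).Finite) ∧
    ∃ σ : ℕ, 1 ≤ σ ∧
      (∀ R : EuclideanSpace ℝ (Fin 2) ≃ₗᵢ[ℝ] EuclideanSpace ℝ (Fin 2),
        IsCoincidenceReflection L R → coincidenceIndex L R = σ) ∧
      (fun x : ℝ => (wellRoundedCount L x : ℝ) - Real.log 3 / (4 * (σ : ℝ)) * x)
        =O[atTop] (fun x : ℝ => Real.sqrt x) := by
  have hE : Module.finrank ℝ (EuclideanSpace ℝ (Fin 2)) = 2 := finrank_euclideanSpace_fin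
  obtain ⟨R₁, R₂, -, hset⟩ := Set.encard_eq_two.1 h2
  have hR₁ : IsCoincidenceReflection L R₁ := by
    have : R₁ ∈ ({R₁, R₂} : Set _) := by simp
    rwa [← hset] at this
  obtain ⟨⟨u, hu, rfl⟩, hc⟩ := hR₁
  obtain ⟨e, f, d, hspan, h⟩ := exists_isCongruenceLattice_cslOf hE L hu hc
  simp only [← hspan] at h hc hset
  -- The reflection along f is minus the one along e: it is again a coincidence reflection, distinct
  -- from the first, hence the second of the two.
  have hcf : IsCoincidenceIsometry L (Submodule.span ℝ {f})ᗮ.reflection := by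
    rw [IsCoincidenceIsometry, h.frame.cslOf_symm]
    exact hc
  have hne : (Submodule.span ℝ {f})ᗮ.reflection ≠ (Submodule.span ℝ {e})ᗮ.reflection := by
    intro heq
    obtain ⟨t, ht⟩ := Submodule.mem_span_singleton.1 (mem_span_singleton_of_reflection_eq heq)
    have := h.frame.coords_ext (a := t) (b := 0) (c := 0) (d := 1) (by rw [ht]; simp)
    norm_num at this
  have hf : IsCoincidenceReflection L (Submodule.span ℝ {f})ᗮ.reflection :=
    ⟨⟨f, h.frame.right_ne, rfl⟩, hcf⟩
  have hR₂ : (Submodule.span ℝ {f})ᗮ.reflection = R₂ := by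
    have : (Submodule.span ℝ {f})ᗮ.reflection ∈
      {R : EuclideanSpace ℝ (Fin 2) ≃ₗᵢ[ℝ] EuclideanSpace ℝ (Fin 2) |
        IsCoincidenceReflection L R} := hf
    rw [hset] at this
    exact this.resolve_left hne
  have hall : ∀ R, IsCoincidenceReflection L R →
      R = (Submodule.span ℝ {e})ᗮ.reflection ∨ R = (Submodule.span ℝ {f})ᗮ.reflection := by
    intro R hR
    have : R ∈ {R : EuclideanSpace ℝ (Fin 2) ≃ₗᵢ[ℝ] EuclideanSpace ℝ (Fin 2) |
        IsCoincidenceReflection L R} := hR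
    rw [hset, ← hR₂] at this
    exact this
  have haxis : ∀ u : EuclideanSpace ℝ (Fin 2), u ≠ 0 →
      IsCoincidenceIsometry L (Submodule.span ℝ {u})ᗮ.reflection →
      u ∈ Submodule.span ℝ {e} ∨ u ∈ Submodule.span ℝ {f} := fun u hu hcu =>
    (hall _ ⟨⟨u, hu, rfl⟩, hcu⟩).imp mem_span_singleton_of_reflection_eq
      mem_span_singleton_of_reflection_eq
  -- Index 0 would encode infinite index, which full rank of K excludes.
  have hσ : 0 < coincidenceIndex L (Submodule.span ℝ {e})ᗮ.reflection :=
    Nat.pos_of_ne_zero (h.relIndex_ne_zero inf_le_left)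
  refine ⟨fun n _ => h.finite_wellRoundedSublattices haxis hσ n, _, hσ, ?_,
    h.wellRoundedCount_isBigO haxis hσ rfl⟩
  intro R hR
  rcases hall R hR with rfl | rfl
  · rfl
  · rw [coincidenceIndex, h.frame.cslOf_symm, coincidenceIndex]
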